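/- For each $n\ge 1$ let $B_1,\dots,B_n$ be i.i.d. Bernoulli$(1/2)$ random variables, $H_n=\frac1{n^2}\sum_{i=1}^n iB_i$ and $\tilde H_n=-H_n$. Let $$\tilde K(\theta)=\lim_{n\to\infty}\frac1n\ln\mathbb E\big[e^{\theta n\tilde H_n}\big],\qquad K(\theta)=\lim_{n\to\infty}\frac1n\ln\mathbb E\big[e^{\theta nH_n}\big]\qquad(\theta\in\mathbb R),$$ $$\tilde I(\tilde d)=\sup_{\theta\in\mathbb R}\{\theta\tilde d-\tilde K(\theta)\},\qquad I(d)=\sup_{\theta\in\mathbb R}\{\theta d-K(\theta)\},\qquad \tilde H(\theta)=\tfrac12\ln\frac{1+e^{-\theta}}2 .$$ These limits exist, with $\tilde K(\theta)=\int_0^1\ln\frac{1+e^{-\theta x}}2\,dx$ and $K(\theta)=\int_0^1\ln\frac{1+e^{\theta x}}2\,dx$; $\tilde K$ and $K$ are $C^2$ with $\tilde K''>0$ and $K''>0$; for every $\tilde d\in(-\frac12,0)$ the equation $\tilde K'(\tilde\theta_{\tilde d})=\tilde d$ has exactly one real solution and $\tilde I(\tilde d)<\infty$; for every $d\in(0,\frac12)$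 the equation $K'(\theta_d)=d$ has exactly one real solution and $I(d)<\infty$. Let $0<\omega_1\le\omega_2<\frac14$. (a) There are deterministic functions $\tilde\varrho_n$ with $\sup_{\tilde d\in[-\omega_2,-\omega_1]}|\tilde\varrho_n(\tilde d)|\to0$ as $n\to\infty$ such that for all $\tilde d\in[-\omega_2,-\omega_1]$ one has $\tilde\theta_{\tilde d}>0$ and, for all $n\ge1$, $$\Pr[\tilde H_n\ge\tilde d]=\frac{\exp\big(-n\tilde I(\tilde d)+\tilde H(\tilde\theta_{\tilde d})\big)}{\tilde\theta_{\tilde d}\sqrt{2\pi n\tilde K''(\tilde\theta_{\tilde d})}}\big(1+\tilde\varrho_n(\tilde d)\big)=\sqrt{\frac{1+e^{-\tilde\theta_{\tilde d}}}{4\pi n\tilde K''(\tilde\theta_{\tilde d})\tilde\theta_{\tilde d}^2}}\;e^{-n\tilde I(\tilde d)}\big(1+\tilde\varrho_n(\tilde d)\big).$$ (b) There are deterministic functions $\varrho_n$ with $\sup_{d\in[\omega_1,\omega_2]}|\varrho_n(d)|\to0$ as $n\to\infty$ such that for all $d\in[\omega_1,\omega_2]$ one has $\theta_d<0$ and, for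 all $n\ge1$, $$\Pr[H_n\le d]=\frac1{\sqrt n}\sqrt{\frac{1+e^{\theta_d}}{4\pi K''(\theta_d)\theta_d^2}}\;e^{-nI(d)}\big(1+\varrho_n(d)\big).$$ -/

import Mathlib

open MeasureTheory ProbabilityTheory Filter Topology Set

noncomputable section

namespace StrongLD

/-- The Bernoulli(1/2) distribution on `{0, 1} ⊆ ℝ`. -/
abbrev fairBernoulli : Measure ℝ :=
  bernoulliMeasure (1 : ℝ) 0 ⟨1 / 2, by constructor <;> norm_num⟩

/-- The joint distribution of `n` i.i.d. Bernoulli(1/2) random variables. -/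
abbrev bitsLaw (n : ℕ) : Measure (Fin n → ℝ) :=
  Measure.pi fun _ => fairBernoulli

/-- `H_n = (1/n²) ∑_{i=1}^n i B_i`, as a function of `b = (B_1, …, B_n)`
(the coordinate of index `i : Fin n` is `B_{i+1}`). -/
def H (n : ℕ) (b : Fin n → ℝ) : ℝ :=
  1 / (n : ℝ) ^ 2 * ∑ i : Fin n, ((i : ℝ) + 1) * b i

/-- `H̃_n = -H_n`. -/
def Ht (n : ℕ) (b : Fin n → ℝ) : ℝ := -H n b

/-- For a statistic `X_n = X n (B_1, …, B_n)` of i.i.d. fair bits, the normalized cumulant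
generating function `(1/n) ln E[exp (θ n X_n)]`. -/
def normCGF (X : ∀ n : ℕ, (Fin n → ℝ) → ℝ) (n : ℕ) (θ : ℝ) : ℝ :=
  1 / (n : ℝ) * cgf (X n) (bitsLaw n) (θ * n)

/-- The limit as `n → ∞` of the normalized cumulant generating functions. -/
def limitCGF (X : ∀ n : ℕ, (Fin n → ℝ) → ℝ) (θ : ℝ) : ℝ :=
  limUnder atTop fun n : ℕ => normCGF X n θ

/-- `K(θ) = lim_n (1/n) ln E[exp (θ n H_n)]`. -/
def K : ℝ → ℝ := limitCGF H

/-- `K̃(θ) = lim_n (1/n) ln E[exp (θ n H̃_n)]`. -/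
def Kt : ℝ → ℝ := limitCGF Ht

/-- The Legendre transform `sup_θ (θ d - Λ(θ))`. -/
def legendre (Λ : ℝ → ℝ) (d : ℝ) : ℝ := ⨆ θ : ℝ, (θ * d - Λ θ)

/-- The correction `H̃(θ) = (1/2) ln ((1 + e^{-θ})/2)` of order `1/n` to `K̃`. -/
def corr (θ : ℝ) : ℝ := 1 / 2 * Real.log ((1 + Real.exp (-θ)) / 2)

end StrongLD

end

noncomputable section

namespace StrongLD

open Real (sigmoid)

/-! The proof is an exact lattice saddlepoint formula followed by dominated convergence. Put S = ∑ i
Bᵢ, which takes values in ℕ. The event d ≤ H̃ₙ is S ≤ m with m = ⌊-n²d⌋. For w = -h + it with h > 0,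
expanding 1/(1 - e^w) as a geometric series shows that the indicator of S ≤ m is the average over
|t| ≤ π of e^{w(S-m)}/(1 - e^w). Taking expectations writes the tail as an integral of ∏ (1 +
e^{wk})/2 (`measureReal_wsum_le`).

Choose h = θ/n, where K̃'(θ) = d. The product is then exp(∑ ln((1 + e^{-θk/n})/2)) times the
characteristic function of S under the exponentially tilted law (`prod_eq_tiltChar`). The
trapezoidal rule gives the exponent as n K̃(θ) + `corr θ` + O(1/n), so the correction is the
boundary term of a Riemann sum (`exists_sumCGF_sub_le`).

The tilted mean of S differs from m by O(n), and the tilted variance is n³K̃''(θ) + O(n²). With t =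
s/n^{3/2} the tilted characteristic function, centred at m, tends to exp(-s²K̃''(θ)/2). Also h/(1 -
e^w) → 1, since t is negligible against h: the lattice is too fine to be felt. The majorant C/(1 +
s²) (`exists_norm_tiltChar_le`) allows integration of the limit and gives √(2π/K̃''(θ))
(`tendsto_integral_cutKernel_sub`).

All limits are taken along `atTop ×ˢ 𝓟 (Icc a b)` in (n, θ), which encodes uniformity in θ. The
condition ω₂ < 1/4 keeps θ away from 0, because K̃'(0) = -1/4. The left tail follows by reflection.
-/

/-- The logarithmic moment generating function `y ↦ ln ((1 + e^{-y}) / 2)` of minus a fair bit. -/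
def bitCGF (y : ℝ) : ℝ := Real.log ((1 + Real.exp (-y)) / 2)

/-- The integral formula for `K̃`. -/
def intCGF (θ : ℝ) : ℝ := ∫ x in (0 : ℝ)..1, bitCGF (θ * x)

/-- The integral formula for `K̃'`. -/
def intCGF' (θ : ℝ) : ℝ := ∫ x in (0 : ℝ)..1, x * -sigmoid (-(θ * x))

/-- The integral formula for `K̃''`. -/
def intCGF'' (θ : ℝ) : ℝ :=
  ∫ x in (0 : ℝ)..1, x * (x * (sigmoid (θ * x) * sigmoid (-(θ * x))))

/-! ### The limiting cumulant function, its derivatives and its Legendre transform -/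

lemma hasDerivAt_bitCGF (y : ℝ) : HasDerivAt bitCGF (-sigmoid (-y)) y := by
  have h1 : HasDerivAt (fun y : ℝ => (1 + Real.exp (-y)) / 2) (Real.exp (-y) * (-1) / 2) y := by
    have := (((hasDerivAt_id y).neg.exp).const_add 1).div_const 2
    simpa using this
  have h2 := h1.log (by positivity)
  refine h2.congr_deriv ?_
  rw [Real.sigmoid_def, neg_neg, Real.exp_neg]
  have := Real.exp_pos y
  field_simp
  ring

lemma hasDerivAt_neg_sigmoid_neg (y : ℝ) :
    HasDerivAt (fun y => -sigmoid (-y)) (sigmoid y * sigmoid (-y)) y := by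
  have := ((Real.hasDerivAt_sigmoid (-y)).comp y (hasDerivAt_neg y)).neg
  refine this.congr_deriv ?_
  rw [Real.sigmoid_neg]; ring

lemma continuous_sigmoid_neg : Continuous fun y : ℝ => -sigmoid (-y) := by
  have := continuous_sigmoid
  fun_prop

/-- Differentiation under the integral: the derivative is jointly continuous, hence bounded on a
compact neighbourhood of θ times [0, 1]. Used with g = 1 for K̃' and g = x for K̃''. -/
lemma hasDerivAt_integral_comp_mul {g h h' : ℝ → ℝ} (hg : Continuous g)
    (hh' : Continuous h') (hd : ∀ y, HasDerivAt h (h' y) y) (θ : ℝ) :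
    HasDerivAt (fun θ => ∫ x in (0 : ℝ)..1, g x * h (θ * x))
      (∫ x in (0 : ℝ)..1, g x * (x * h' (θ * x))) θ := by
  have hh : Continuous h := continuous_iff_continuousAt.2 fun y => (hd y).continuousAt
  have hcont : Continuous fun p : ℝ × ℝ => g p.2 * (p.2 * h' (p.1 * p.2)) := by fun_prop
  obtain ⟨C, hC⟩ := ((isCompact_closedBall θ 1).prod (isCompact_Icc (a := (0 : ℝ)) (b := 1))
    ).exists_bound_of_continuousOn hcont.continuousOn
  refine (intervalIntegral.hasDerivAt_integral_of_dominated_loc_of_deriv_le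
    (F' := fun θ x => g x * (x * h' (θ * x))) (bound := fun _ => C)
    (Metric.closedBall_mem_nhds θ one_pos) ?_ ?_ ?_ ?_ ?_ ?_).2
  · exact Eventually.of_forall fun x => Continuous.aestronglyMeasurable (by fun_prop)
  · exact Continuous.intervalIntegrable (by fun_prop) _ _
  · exact Continuous.aestronglyMeasurable (by fun_prop)
  · refine Eventually.of_forall fun t ht x hx => hC (x, t) ⟨hx, ?_⟩
    rw [uIoc_of_le zero_le_one] at ht
    exact ⟨ht.1.le, ht.2⟩
  · exact intervalIntegrable_const
  · refine Eventually.of_forall fun t _ x _ => ?_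
    have := ((hd (x * t)).comp x ((hasDerivAt_id x).mul_const t)).const_mul (g t)
    refine this.congr_deriv ?_
    ring

lemma hasDerivAt_intCGF (θ : ℝ) : HasDerivAt intCGF (intCGF' θ) θ := by
  have := hasDerivAt_integral_comp_mul (g := fun _ => 1) continuous_const
    continuous_sigmoid_neg hasDerivAt_bitCGF θ
  simp only [one_mul] at this
  refine this.congr_deriv ?_
  rfl

lemma hasDerivAt_intCGF' (θ : ℝ) : HasDerivAt intCGF' (intCGF'' θ) θ :=
  hasDerivAt_integral_comp_mul continuous_id
    (continuous_sigmoid.mul (continuous_sigmoid.comp continuous_neg))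
    hasDerivAt_neg_sigmoid_neg θ

lemma continuous_intCGF'' : Continuous intCGF'' := by
  have := continuous_sigmoid
  exact intervalIntegral.continuous_parametric_intervalIntegral_of_continuous'
    (f := fun θ x => x * (x * (sigmoid (θ * x) * sigmoid (-(θ * x))))) (by fun_prop) _ _

lemma intCGF''_pos (θ : ℝ) : 0 < intCGF'' θ := by
  have := continuous_sigmoid
  refine intervalIntegral.intervalIntegral_pos_of_pos_on
    (Continuous.intervalIntegrable (by fun_prop) _ _) (fun x hx => ?_) one_pos
  have := hx.1
  have := Real.sigmoid_pos (θ * x)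
  have := Real.sigmoid_pos (-(θ * x))
  positivity

lemma deriv_intCGF : deriv intCGF = intCGF' := funext fun θ => (hasDerivAt_intCGF θ).deriv

lemma deriv_intCGF' : deriv intCGF' = intCGF'' := funext fun θ => (hasDerivAt_intCGF' θ).deriv

lemma contDiff_intCGF : ContDiff ℝ 2 intCGF := by
  rw [show (2 : WithTop ℕ∞) = 1 + 1 by norm_num, contDiff_succ_iff_deriv]
  refine ⟨fun θ => (hasDerivAt_intCGF θ).differentiableAt, by simp, ?_⟩
  rw [deriv_intCGF, contDiff_one_iff_deriv, deriv_intCGF']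
  exact ⟨fun θ => (hasDerivAt_intCGF' θ).differentiableAt, continuous_intCGF''⟩

lemma strictMono_intCGF' : StrictMono intCGF' :=
  strictMono_of_deriv_pos fun θ => by rw [deriv_intCGF']; exact intCGF''_pos θ

lemma continuous_intCGF' : Continuous intCGF' :=
  continuous_iff_continuousAt.2 fun y => (hasDerivAt_intCGF' y).continuousAt

lemma intCGF'_zero : intCGF' 0 = -1 / 4 := by
  simp [intCGF', Real.sigmoid_zero]
  norm_num

/-- From σ(-y) = 1 - σ(y). With this symmetry one bound near 0 controls K̃' at both ends of (-1/2,
0). -/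
lemma intCGF'_neg (θ : ℝ) : intCGF' (-θ) = -1 / 2 - intCGF' θ := by
  have := continuous_sigmoid
  have h : intCGF' (-θ) + intCGF' θ = ∫ x in (0 : ℝ)..1, -x := by
    rw [intCGF', intCGF', ← intervalIntegral.integral_add
      (Continuous.intervalIntegrable (by fun_prop) _ _)
      (Continuous.intervalIntegrable (by fun_prop) _ _)]
    congr 1; ext x
    rw [Real.sigmoid_neg (θ * x), neg_mul, neg_neg]; ring
  rw [intervalIntegral.integral_neg, integral_id] at h
  linarith

/-- Since y ≤ 1 + e^y, one has y σ(-y) ≤ 1; this bounds the integrand pointwise. -/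
lemma neg_inv_le_intCGF' {θ : ℝ} (hθ : 0 < θ) : -(1 / θ) ≤ intCGF' θ := by
  have := continuous_sigmoid
  have h : ∫ x in (0 : ℝ)..1, -(1 / θ) ≤ intCGF' θ := by
    refine intervalIntegral.integral_mono_on zero_le_one intervalIntegrable_const
      (Continuous.intervalIntegrable (by fun_prop) _ _) fun x hx => ?_
    have h1 : sigmoid (-(θ * x)) * (θ * x) ≤ 1 := by
      rw [Real.sigmoid_def, neg_neg, inv_mul_le_iff₀ (by positivity)]
      have := Real.add_one_le_exp (θ * x)
      linarith
    have : x * sigmoid (-(θ * x)) ≤ 1 / θ := by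
      rw [le_div_iff₀ hθ]; linarith
    linarith
  simpa using h

lemma exists_intCGF'_eq {d : ℝ} (hd : d ∈ Ioo (-1 / 2 : ℝ) 0) : ∃ θ, intCGF' θ = d := by
  have hlow : ∃ θ, intCGF' θ ≤ d := by
    have h0 : 0 < d + 1 / 2 := by linarith [hd.1]
    refine ⟨-(1 / (d + 1 / 2)), ?_⟩
    have := neg_inv_le_intCGF' (θ := 1 / (d + 1 / 2)) (by positivity)
    rw [intCGF'_neg]
    rw [one_div_one_div] at this
    linarith
  have hhigh : ∃ θ, d ≤ intCGF' θ := by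
    have h0 : 0 < -d := by linarith [hd.2]
    refine ⟨1 / (-d), ?_⟩
    have := neg_inv_le_intCGF' (θ := 1 / (-d)) (by positivity)
    rw [one_div_one_div] at this
    linarith
  obtain ⟨u, hu⟩ := hlow
  obtain ⟨v, hv⟩ := hhigh
  exact mem_range_of_exists_le_of_exists_ge continuous_intCGF' ⟨u, hu⟩ ⟨v, hv⟩

/-- The function η ↦ K̃(η) - η K̃'(θ) is convex with zero derivative at θ, so θ is its global
minimum. -/
lemma intCGF_legendre_le (θ η : ℝ) :
    η * intCGF' θ - intCGF η ≤ θ * intCGF' θ - intCGF θ := by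
  have hconv : ConvexOn ℝ univ intCGF := by
    refine (strictConvexOn_univ_of_deriv2_pos (contDiff_intCGF.continuous) fun x => ?_).convexOn
    simp only [Function.iterate_succ, Function.iterate_zero, Function.comp_def, id]
    rw [deriv_intCGF, deriv_intCGF']
    exact intCGF''_pos x
  have hconv2 : ConvexOn ℝ univ fun x => intCGF x - x * intCGF' θ := by
    refine hconv.sub ⟨convex_univ, fun x _ y _ a b _ _ _ => ?_⟩
    simp only [smul_eq_mul]
    linarith
  have hd : HasDerivAt (fun x => intCGF x - x * intCGF' θ) 0 θ := by
    refine ((hasDerivAt_intCGF θ).sub ((hasDerivAt_id θ).mul_const _)).congr_deriv ?_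
    simp
  have := hconv2.isMinOn_of_rightDeriv_eq_zero (x := θ) (by simp)
    (by rw [hd.hasDerivWithinAt.derivWithin (uniqueDiffWithinAt_Ioi θ)])
  have := this (mem_univ η)
  simp only [mem_ofPred_eq] at this
  linarith

lemma bddAbove_intCGF_legendre {d θ : ℝ} (h : intCGF' θ = d) :
    BddAbove (range fun η => η * d - intCGF η) := by
  subst h
  exact ⟨_, by rintro _ ⟨η, rfl⟩; exact intCGF_legendre_le θ η⟩

lemma legendre_intCGF {d θ : ℝ} (h : intCGF' θ = d) :
    legendre intCGF d = θ * d - intCGF θ := by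
  refine le_antisymm (ciSup_le fun η => ?_) (le_ciSup (bddAbove_intCGF_legendre h) θ)
  subst h
  exact intCGF_legendre_le θ η

/-! ### Riemann sums with explicit errors -/

lemma abs_sum_sub_integral_le {f f' : ℝ → ℝ} {C : ℝ} (hf : ∀ x, HasDerivAt f (f' x) x)
    (hC : ∀ x ∈ Icc (0 : ℝ) 1, |f' x| ≤ C) {n : ℕ} (hn : 1 ≤ n) :
    |∑ i : Fin n, f (((i : ℝ) + 1) / n) - n * ∫ x in (0 : ℝ)..1, f x| ≤ C := by
  have hn0 : (0 : ℝ) < n := by exact_mod_cast hn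
  have hfc : Continuous f := continuous_iff_continuousAt.2 fun y => (hf y).continuousAt
  have hsum : ∑ k ∈ Finset.range n, ∫ x in ((k : ℕ) : ℝ) / n..((k + 1 : ℕ) : ℝ) / n, f x
      = ∫ x in (0 : ℝ)..1, f x := by
    rw [intervalIntegral.sum_integral_adjacent_intervals (a := fun k : ℕ => (k : ℝ) / n)
      (fun k _ => hfc.intervalIntegrable _ _)]
    simp [hn0.ne']
  have hterm : ∀ k ∈ Finset.range n,
      |f (((k : ℝ) + 1) / n) - n * ∫ x in ((k : ℕ) : ℝ) / n..((k + 1 : ℕ) : ℝ) / n, f x|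
        ≤ C / n := by
    intro k hk
    have hk1 : (k : ℝ) + 1 ≤ n := by exact_mod_cast Finset.mem_range.1 hk
    have hle : ((k : ℕ) : ℝ) / n ≤ ((k + 1 : ℕ) : ℝ) / n := by gcongr; simp
    have hlen : ((k + 1 : ℕ) : ℝ) / n - (k : ℝ) / n = 1 / n := by push_cast; ring
    have hmem : ∀ x ∈ Icc ((k : ℝ) / n) (((k + 1 : ℕ) : ℝ) / n), x ∈ Icc (0 : ℝ) 1 := by
      intro x hx
      refine ⟨le_trans (by positivity) hx.1, hx.2.trans ?_⟩
      rw [div_le_one hn0]; push_cast; exact hk1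
    have key : ‖∫ x in ((k : ℕ) : ℝ) / n..((k + 1 : ℕ) : ℝ) / n,
        (f (((k : ℝ) + 1) / n) - f x)‖ ≤ (C / n) * |((k + 1 : ℕ) : ℝ) / n - (k : ℝ) / n| := by
      refine intervalIntegral.norm_integral_le_of_norm_le_const fun x hx => ?_
      rw [uIoc_of_le hle] at hx
      have hx' : x ∈ Icc ((k : ℝ) / n) (((k + 1 : ℕ) : ℝ) / n) := ⟨hx.1.le, hx.2⟩
      have := (convex_Icc (0 : ℝ) 1).norm_image_sub_le_of_norm_hasDerivWithin_le
        (fun y hy => (hf y).hasDerivWithinAt) (fun y hy => hC y hy) (hmem x hx')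
        (hmem _ ⟨hle, le_rfl⟩)
      have hC0 : 0 ≤ C := (abs_nonneg _).trans (hC 0 (by simp))
      push_cast at this hx
      refine this.trans ?_
      rw [div_eq_mul_one_div C]
      gcongr
      rw [Real.norm_eq_abs, abs_of_nonneg (by linarith [hx.2])]
      push_cast at hlen
      linarith [hx.1]
    rw [intervalIntegral.integral_sub intervalIntegrable_const (hfc.intervalIntegrable _ _),
      intervalIntegral.integral_const, hlen, smul_eq_mul, Real.norm_eq_abs,
      abs_of_pos (one_div_pos.2 hn0)] at key
    have := mul_le_mul_of_nonneg_left key hn0.le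
    rw [← abs_of_pos hn0, ← abs_mul, abs_of_pos hn0] at this
    refine le_trans (le_of_eq ?_) (this.trans (le_of_eq ?_))
    · rw [mul_sub, ← mul_assoc, mul_one_div_cancel hn0.ne', one_mul]
    · field_simp
  rw [Fin.sum_univ_eq_sum_range (fun k => f (((k : ℝ) + 1) / n)) n, ← hsum, Finset.mul_sum,
    ← Finset.sum_sub_distrib]
  refine (Finset.abs_sum_le_sum_abs _ _).trans ((Finset.sum_le_sum hterm).trans ?_)
  simp [mul_div_cancel₀ _ hn0.ne']

/-- The right-endpoint sum is n times the trapezoidal approximation plus (f 1 - f 0)/2, and n times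
the trapezoidal error is at most C/(12 n). -/
lemma abs_sum_sub_integral_sub_le {f f' f'' : ℝ → ℝ} {C : ℝ} (hf : ∀ x, HasDerivAt f (f' x) x)
    (hf' : ∀ x, HasDerivAt f' (f'' x) x)
    (hC : ∀ x ∈ Icc (0 : ℝ) 1, |f'' x| ≤ C) {n : ℕ} (hn : 1 ≤ n) :
    |∑ i : Fin n, f (((i : ℝ) + 1) / n) - n * (∫ x in (0 : ℝ)..1, f x) - (f 1 - f 0) / 2|
      ≤ C / n := by
  have hn0 : (0 : ℝ) < n := by exact_mod_cast hn
  have hu : UniqueDiffOn ℝ (Icc (0 : ℝ) 1) := uniqueDiffOn_Icc one_pos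
  have h1 : ∀ x ∈ Icc (0 : ℝ) 1, derivWithin f (Icc 0 1) x = f' x := fun x hx =>
    (hf x).hasDerivWithinAt.derivWithin (hu x hx)
  have hC0 : 0 ≤ C := (abs_nonneg _).trans (hC 0 (by simp))
  have hd2 : ∀ x ∈ Icc (0 : ℝ) 1,
      HasDerivWithinAt (derivWithin f (Icc 0 1)) (f'' x) (Icc 0 1) x := fun x hx =>
    (hf' x).hasDerivWithinAt.congr h1 (h1 x hx)
  have key := trapezoidal_error_le (f := f) (a := 0) (b := 1) (ζ := C) (N := n)
    (fun x _ => (hf x).differentiableAt.differentiableWithinAt)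
    (by
      rw [uIcc_of_le zero_le_one]
      exact fun x hx => (hd2 x hx).differentiableWithinAt)
    (by
      intro x
      rw [uIcc_of_le zero_le_one, iteratedDerivWithin_succ, iteratedDerivWithin_one]
      by_cases hx : x ∈ Icc (0 : ℝ) 1
      · rw [(hd2 x hx).derivWithin (hu x hx)]
        exact hC x hx
      -- The trapezoidal bound asks for all real x; outside [0, 1] the derivative within the
      -- interval is 0 by convention.
      · rw [derivWithin_zero_of_notMem_closure (by rwa [isClosed_Icc.closure_eq])]
        simpa using hC0)
    (by omega)
  obtain ⟨m, rfl⟩ : ∃ m, n = m + 1 := ⟨n - 1, by omega⟩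
  have hsum : ∑ i : Fin (m + 1), f (((i : ℝ) + 1) / (m + 1 : ℕ))
      = ∑ k ∈ Finset.range m, f (((k : ℝ) + 1) / (m + 1 : ℕ)) + f 1 := by
    rw [Fin.sum_univ_eq_sum_range (fun k => f (((k : ℝ) + 1) / (m + 1 : ℕ))) (m + 1),
      Finset.sum_range_succ]
    congr 2
    push_cast at hn0 ⊢
    field_simp
  rw [trapezoidal_error, trapezoidal_integral] at key
  simp only [Nat.add_sub_cancel, zero_add, sub_zero, mul_one, one_pow, one_mul, abs_one] at key
  have h2 := mul_le_mul_of_nonneg_left key hn0.le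
  rw [← abs_of_pos hn0, ← abs_mul, abs_of_pos hn0] at h2
  rw [hsum]
  refine le_trans (le_of_eq ?_) (h2.trans ?_)
  · congr 1
    field_simp
    ring
  · rw [mul_div_assoc', div_le_div_iff₀ (by positivity) hn0]
    nlinarith [mul_nonneg hC0 (sq_nonneg ((m + 1 : ℕ) : ℝ))]

lemma exists_abs_sum_sub_integral_le {G G' : ℝ → ℝ → ℝ}
    (hG : ∀ θ x, HasDerivAt (G θ) (G' θ x) x) (hG' : Continuous G'.uncurry) {S : Set ℝ}
    (hS : IsCompact S) :
    ∃ C, ∀ θ ∈ S, ∀ n : ℕ, 1 ≤ n →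
      |∑ i : Fin n, G θ (((i : ℝ) + 1) / n) - n * ∫ x in (0 : ℝ)..1, G θ x| ≤ C := by
  obtain ⟨C, hC⟩ := (hS.prod (isCompact_Icc (a := (0 : ℝ)) (b := 1))
    ).exists_bound_of_continuousOn hG'.continuousOn
  exact ⟨C, fun θ hθ n hn => abs_sum_sub_integral_le (hG θ) (fun x hx => hC (θ, x) ⟨hθ, hx⟩) hn⟩

/-! ### Exact cumulant, mean and variance sums against their integrals -/

/-- The exact normalizing exponent `n K̃_n(θ) = ∑ ln ((1 + e^{-θ k / n}) / 2)`. -/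
def sumCGF (n : ℕ) (θ : ℝ) : ℝ := ∑ i : Fin n, bitCGF (θ * (((i : ℝ) + 1) / n))

lemma hasDerivAt_bitCGF_mul (θ x : ℝ) :
    HasDerivAt (fun x => bitCGF (θ * x)) (θ * -sigmoid (-(θ * x))) x := by
  have := (hasDerivAt_bitCGF (θ * x)).comp x ((hasDerivAt_id x).const_mul θ)
  exact this.congr_deriv (by simp [mul_comm])

lemma hasDerivAt_neg_sigmoid_neg_mul (θ x : ℝ) :
    HasDerivAt (fun x => -sigmoid (-(θ * x)))
      (θ * (sigmoid (θ * x) * sigmoid (-(θ * x)))) x := by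
  have := (hasDerivAt_neg_sigmoid_neg (θ * x)).comp x ((hasDerivAt_id x).const_mul θ)
  exact this.congr_deriv (by simp [mul_comm])

lemma hasDerivAt_sigmoid_mul_sigmoid (y : ℝ) :
    HasDerivAt (fun y => sigmoid y * sigmoid (-y))
      (sigmoid y * sigmoid (-y) * (1 - 2 * sigmoid y)) y := by
  have h := (Real.hasDerivAt_sigmoid y).mul ((hasDerivAt_neg_sigmoid_neg y).neg)
  simp only [Pi.neg_apply, neg_neg] at h
  have h2 : (sigmoid * -fun y => -sigmoid (-y)) = fun y => sigmoid y * sigmoid (-y) := by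
    ext; simp
  rw [h2] at h
  refine h.congr_deriv ?_
  rw [Real.sigmoid_neg]; ring

/-- As `bitCGF 0 = 0`, the boundary term of the trapezoidal rule is half of `bitCGF θ`, which is
`corr θ`. -/
lemma exists_sumCGF_sub_le {S : Set ℝ} (hS : IsCompact S) :
    ∃ C, ∀ θ ∈ S, ∀ n : ℕ, 1 ≤ n → |sumCGF n θ - n * intCGF θ - corr θ| ≤ C / n := by
  have hc : Continuous fun p : ℝ × ℝ =>
      p.1 * (p.1 * (sigmoid (p.1 * p.2) * sigmoid (-(p.1 * p.2)))) := by
    have := continuous_sigmoid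
    fun_prop
  obtain ⟨C, hC⟩ := (hS.prod (isCompact_Icc (a := (0 : ℝ)) (b := 1))
    ).exists_bound_of_continuousOn hc.continuousOn
  refine ⟨C, fun θ hθ n hn => ?_⟩
  have := abs_sum_sub_integral_sub_le (hasDerivAt_bitCGF_mul θ)
    (fun x => (hasDerivAt_neg_sigmoid_neg_mul θ x).const_mul θ)
    (fun x hx => hC (θ, x) ⟨hθ, hx⟩) hn
  convert this using 2
  simp [sumCGF, intCGF, corr, bitCGF]
  ring

lemma tendsto_sumCGF_div (θ : ℝ) :
    Tendsto (fun n : ℕ => 1 / (n : ℝ) * sumCGF n θ) atTop (𝓝 (intCGF θ)) := by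
  obtain ⟨C, hC⟩ := exists_sumCGF_sub_le (isCompact_singleton (x := θ))
  rw [tendsto_iff_norm_sub_tendsto_zero]
  refine squeeze_zero' (g := fun n : ℕ => (C + |corr θ|) / (n : ℝ))
    (Eventually.of_forall fun _ => norm_nonneg _) ?_
    (tendsto_const_div_atTop_nhds_zero_nat _)
  filter_upwards [eventually_ge_atTop 1] with n hn
  have hn0 : (1 : ℝ) ≤ n := by exact_mod_cast hn
  have h := hC θ rfl n hn
  have hC0 : 0 ≤ C / n := (abs_nonneg _).trans h
  have hC1 : C / n ≤ C := by
    refine div_le_self ?_ hn0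
    by_contra! hneg
    exact absurd hC0 (not_le.2 (div_neg_of_neg_of_pos hneg (by linarith)))
  rw [Real.norm_eq_abs, le_div_iff₀ (by linarith)]
  have h2 : |1 / (n : ℝ) * sumCGF n θ - intCGF θ| * n = |sumCGF n θ - n * intCGF θ| := by
    nth_rewrite 2 [← abs_of_pos (by linarith : (0 : ℝ) < n)]
    rw [← abs_mul]
    congr 1
    field_simp
  rw [h2]
  have := abs_add_le (sumCGF n θ - n * intCGF θ - corr θ) (corr θ)
  rw [sub_add_cancel] at this
  linarith

lemma exists_sum_mean_le {S : Set ℝ} (hS : IsCompact S) :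
    ∃ C, ∀ θ ∈ S, ∀ n : ℕ, 1 ≤ n →
      |∑ i : Fin n, ((i : ℝ) + 1) / n * -sigmoid (-(θ * (((i : ℝ) + 1) / n))) - n * intCGF' θ|
        ≤ C := by
  refine exists_abs_sum_sub_integral_le (G := fun θ x => x * -sigmoid (-(θ * x)))
    (G' := fun θ x => 1 * -sigmoid (-(θ * x)) +
      x * (θ * (sigmoid (θ * x) * sigmoid (-(θ * x)))))
    (fun θ x => (hasDerivAt_id x).mul (hasDerivAt_neg_sigmoid_neg_mul θ x)) ?_ hS
  have := continuous_sigmoid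
  simp only [Function.uncurry_def]
  fun_prop

lemma exists_sum_variance_le {S : Set ℝ} (hS : IsCompact S) :
    ∃ C, ∀ θ ∈ S, ∀ n : ℕ, 1 ≤ n →
      |∑ i : Fin n, ((i : ℝ) + 1) / n * (((i : ℝ) + 1) / n *
        (sigmoid (θ * (((i : ℝ) + 1) / n)) * sigmoid (-(θ * (((i : ℝ) + 1) / n))))) -
        n * intCGF'' θ| ≤ C := by
  refine exists_abs_sum_sub_integral_le
    (G := fun θ x => x * (x * (sigmoid (θ * x) * sigmoid (-(θ * x)))))
    (G' := fun θ x => 1 * (x * (sigmoid (θ * x) * sigmoid (-(θ * x)))) +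
      x * (1 * (sigmoid (θ * x) * sigmoid (-(θ * x))) +
        x * (sigmoid (θ * x) * sigmoid (-(θ * x)) * (1 - 2 * sigmoid (θ * x)) * θ)))
    (fun θ x => ?_) ?_ hS
  · have h := (hasDerivAt_sigmoid_mul_sigmoid (θ * x)).comp x ((hasDerivAt_id x).const_mul θ)
    rw [mul_one] at h
    exact (hasDerivAt_id x).mul ((hasDerivAt_id x).mul h)
  · have := continuous_sigmoid
    simp only [Function.uncurry_def]
    fun_prop

/-! ### The law of the bits and the limits of the normalized cumulant functions -/

/-- The weighted sum `∑ i B_i`. -/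
def wsum {n : ℕ} (b : Fin n → ℝ) : ℝ := ∑ i : Fin n, ((i : ℝ) + 1) * b i

lemma measurable_wsum {n : ℕ} : Measurable (wsum (n := n)) := by
  unfold wsum
  fun_prop

lemma Ht_eq (n : ℕ) (b : Fin n → ℝ) : Ht n b = -(1 / (n : ℝ) ^ 2 * wsum b) := rfl

lemma integral_bits_prod {𝕜 : Type*} [RCLike 𝕜] {n : ℕ} (f : Fin n → ℝ → 𝕜) :
    ∫ b, ∏ i, f i (b i) ∂(bitsLaw n) = ∏ i, (f i 0 + f i 1) / 2 := by
  rw [integral_fintype_prod_eq_prod]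
  refine Finset.prod_congr rfl fun i _ => ?_
  rw [integral_bernoulliMeasure]
  have h1 : ((1 / 2 : ℝ) : 𝕜) = 1 / 2 := by
    rw [RCLike.ofReal_div, RCLike.ofReal_one, RCLike.ofReal_ofNat]
  have h2 : ((1 - 1 / 2 : ℝ) : 𝕜) = 1 / 2 := by
    rw [← h1]; congr 1; norm_num
  simp only [RCLike.real_smul_eq_coe_mul, h1, h2]
  ring

lemma cgf_Ht {n : ℕ} (hn : 1 ≤ n) (θ : ℝ) :
    cgf (Ht n) (bitsLaw n) (θ * n) = sumCGF n θ := by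
  have hn0 : (n : ℝ) ≠ 0 := by positivity
  have h : mgf (Ht n) (bitsLaw n) (θ * n) =
      ∏ i : Fin n, (1 + Real.exp (-(θ * (((i : ℝ) + 1) / n)))) / 2 := by
    have := integral_bits_prod (n := n)
      (fun i x => Real.exp (-(θ * (((i : ℝ) + 1) / n)) * x))
    simp only [mul_zero, Real.exp_zero, mul_one, ← Real.exp_sum] at this
    rw [← this, mgf]
    congr 1; ext b
    simp only
    rw [Ht_eq, wsum, Finset.mul_sum, ← Finset.sum_neg_distrib, Finset.mul_sum]
    congr 1
    refine Finset.sum_congr rfl fun i _ => ?_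
    field_simp
  rw [cgf, h, Real.log_prod (fun i _ => by positivity)]
  rfl

lemma tendsto_normCGF_Ht (θ : ℝ) :
    Tendsto (fun n => normCGF Ht n θ) atTop (𝓝 (intCGF θ)) := by
  refine (tendsto_sumCGF_div θ).congr' ?_
  filter_upwards [eventually_ge_atTop 1] with n hn
  rw [normCGF, cgf_Ht hn]

lemma Kt_eq : Kt = intCGF := funext fun θ => (tendsto_normCGF_Ht θ).limUnder_eq

lemma normCGF_H (n : ℕ) (θ : ℝ) : normCGF H n θ = normCGF Ht n (-θ) := by
  have : Ht n = -H n := rfl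
  rw [normCGF, normCGF, this, cgf_neg, neg_mul, neg_neg]

lemma tendsto_normCGF_H (θ : ℝ) :
    Tendsto (fun n => normCGF H n θ) atTop (𝓝 (intCGF (-θ))) := by
  simp only [normCGF_H]
  exact tendsto_normCGF_Ht (-θ)

lemma K_eq : K = fun θ => intCGF (-θ) := funext fun θ => (tendsto_normCGF_H θ).limUnder_eq

lemma measureReal_bits {n : ℕ} {Ω : Type*} {_ : MeasurableSpace Ω} {P : Measure Ω}
    [IsProbabilityMeasure P] {B : Fin n → Ω → ℝ} (hB : ∀ i, HasLaw (B i) fairBernoulli P)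
    (hind : iIndepFun B P) {A : Set (Fin n → ℝ)} (hA : MeasurableSet A) :
    P.real {ω | (fun i => B i ω) ∈ A} = (bitsLaw n).real A := by
  have hmap := hind.map_fun_eq_pi_map (fun i => (hB i).aemeasurable)
  simp only [fun i => (hB i).map_eq] at hmap
  rw [bitsLaw, ← hmap, map_measureReal_apply_of_aemeasurable
    (aemeasurable_pi_lambda _ fun i => (hB i).aemeasurable) hA]
  rfl

lemma ae_bits (n : ℕ) : ∀ᵐ b ∂(bitsLaw n), ∃ s : ℕ, wsum b = s := by
  have h0 : ∀ᵐ x ∂fairBernoulli, x = 0 ∨ x = 1 := by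
    have hm : MeasurableSet {x : ℝ | ¬(x = 0 ∨ x = 1)} :=
      ((measurableSet_singleton 0).union (measurableSet_singleton 1)).compl
    rw [ae_iff, bernoulliMeasure_apply_of_notMem_of_notMem _ hm] <;> simp
  have h : ∀ᵐ b ∂(bitsLaw n), ∀ i, b i = 0 ∨ b i = 1 :=
    eventually_all.2 fun i =>
      (Measure.tendsto_eval_ae_ae (μ := fun _ : Fin n => fairBernoulli) (i := i)).eventually h0
  filter_upwards [h] with b hb
  refine ⟨∑ i : Fin n, if b i = 1 then (i : ℕ) + 1 else 0, ?_⟩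
  rw [wsum]
  push_cast
  refine Finset.sum_congr rfl fun i _ => ?_
  rcases hb i with h | h <;> simp [h]

/-! ### Inversion formula for the distribution function of a lattice variable -/

lemma norm_cexp_neg_add (h t : ℝ) (x : ℝ) :
    ‖Complex.exp ((-h + t * Complex.I) * x)‖ = Real.exp (-h * x) := by
  rw [Complex.norm_exp]
  simp

lemma one_sub_exp_neg_add_ne_zero {h : ℝ} (hh : 0 < h) (t : ℝ) :
    1 - Complex.exp (-h + t * Complex.I) ≠ 0 := by
  intro h0
  have h1 := norm_cexp_neg_add h t 1
  rw [Complex.ofReal_one, mul_one, ← sub_eq_zero.1 h0, norm_one, mul_one] at h1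
  exact absurd h1.symm (Real.exp_lt_one_iff.2 (by linarith)).ne

lemma one_sub_exp_neg_le_norm {h : ℝ} (t : ℝ) :
    1 - Real.exp (-h) ≤ ‖1 - Complex.exp (-h + t * Complex.I)‖ := by
  have h1 := norm_cexp_neg_add h t 1
  rw [Complex.ofReal_one, mul_one, mul_one] at h1
  rw [← h1]
  have := norm_sub_norm_le (1 : ℂ) (Complex.exp (-h + t * Complex.I))
  rwa [norm_one] at this

lemma integral_cexp_int (h : ℝ) (k : ℤ) :
    ∫ t in (-Real.pi)..Real.pi, Complex.exp ((-h + t * Complex.I) * k) =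
      if k = 0 then 2 * (Real.pi : ℂ) else 0 := by
  split_ifs with hk
  · subst hk
    simp
    ring
  · have hc : (k : ℂ) * Complex.I ≠ 0 := by simp [hk]
    have : ∀ t : ℝ, Complex.exp ((-h + t * Complex.I) * k) =
        Complex.exp (-h * k) * Complex.exp (k * Complex.I * t) := by
      intro t; rw [← Complex.exp_add]; congr 1; ring
    simp only [this]
    rw [intervalIntegral.integral_const_mul, integral_exp_mul_complex hc]
    have : Complex.exp (k * Complex.I * (Real.pi : ℝ)) =
        Complex.exp (k * Complex.I * ((-Real.pi : ℝ) : ℂ)) := by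
      rw [← mul_one (Complex.exp (k * Complex.I * ((-Real.pi : ℝ) : ℂ))),
        ← Complex.exp_int_mul_two_pi_mul_I k, ← Complex.exp_add]
      congr 1
      push_cast
      ring
    rw [this]
    simp

/-- The geometric series in e^w converges uniformly in t because |e^w| = e^{-h} < 1. Its jth term
integrates to 2π exactly when j = m - s, and such a j ≥ 0 exists iff s ≤ m. -/
lemma integral_cexp_div_one_sub {h : ℝ} (hh : 0 < h) (s m : ℕ) :
    ∫ t in (-Real.pi)..Real.pi, Complex.exp ((-h + t * Complex.I) * (s - m)) /
      (1 - Complex.exp (-h + t * Complex.I)) = if s ≤ m then 2 * (Real.pi : ℂ) else 0 := by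
  have hr : Real.exp (-h) < 1 := Real.exp_lt_one_iff.2 (by linarith)
  have hnorm : ∀ (j : ℕ) (t : ℝ), ‖Complex.exp ((-h + t * Complex.I) * ((s - m + j : ℤ) : ℂ))‖
      = Real.exp (-h * (s - m)) * Real.exp (-h) ^ j := by
    intro j t
    have := norm_cexp_neg_add h t (s - m + j)
    push_cast at this ⊢
    rw [this, ← Real.exp_nat_mul, ← Real.exp_add]
    congr 1
    ring
  have hsumm : Summable fun j : ℕ => Real.exp (-h * (s - m)) * Real.exp (-h) ^ j :=
    (summable_geometric_of_lt_one (Real.exp_pos _).le hr).mul_left _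
  have key := intervalIntegral.hasSum_integral_of_dominated_convergence
    (a := -Real.pi) (b := Real.pi) (μ := volume)
    (F := fun (j : ℕ) (t : ℝ) => Complex.exp ((-h + t * Complex.I) * ((s - m + j : ℤ) : ℂ)))
    (f := fun t => Complex.exp ((-h + t * Complex.I) * (s - m)) /
      (1 - Complex.exp (-h + t * Complex.I)))
    (fun j _ => Real.exp (-h * (s - m)) * Real.exp (-h) ^ j)
    (fun j => Continuous.aestronglyMeasurable (by fun_prop))
    (fun j => Eventually.of_forall fun t _ => (hnorm j t).le)
    (Eventually.of_forall fun t _ => hsumm) intervalIntegrable_const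
    (Eventually.of_forall fun t _ => by
      have hlt : ‖Complex.exp (-h + t * Complex.I)‖ < 1 := by
        have := norm_cexp_neg_add h t 1
        rw [Complex.ofReal_one, mul_one, mul_one] at this
        rwa [this]
      have := (hasSum_geometric_of_norm_lt_one hlt).mul_left
        (Complex.exp ((-h + t * Complex.I) * (s - m)))
      rw [div_eq_mul_inv]
      refine this.congr_fun ?_
      intro j
      rw [← Complex.exp_nat_mul, ← Complex.exp_add]
      congr 1
      push_cast
      ring)
  simp only [integral_cexp_int] at key
  refine key.unique ?_
  split_ifs with hsm
  · have h1 : (fun j : ℕ => if (s : ℤ) - m + j = 0 then 2 * (Real.pi : ℂ) else 0) =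
        fun j => if j = m - s then 2 * (Real.pi : ℂ) else 0 :=
      funext fun j => if_congr (by omega) rfl rfl
    rw [h1]
    exact hasSum_ite_eq _ _
  · have h1 : (fun j : ℕ => if (s : ℤ) - m + j = 0 then 2 * (Real.pi : ℂ) else 0) = fun _ => 0 :=
      funext fun j => if_neg (by omega)
    rw [h1]
    exact hasSum_zero

/-- Fubini applied to the integral representation of the indicator; independence turns the inner
expectation into the product. -/
lemma measureReal_wsum_le {n : ℕ} (m : ℕ) {h : ℝ} (hh : 0 < h) :
    (((bitsLaw n).real {b | wsum b ≤ m} : ℝ) : ℂ) =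
      1 / (2 * Real.pi) * ∫ t in (-Real.pi)..Real.pi,
        Complex.exp (-((-h + t * Complex.I) * m)) *
          (∏ i : Fin n, (1 + Complex.exp ((-h + t * Complex.I) * ((i : ℝ) + 1 : ℝ))) / 2) /
          (1 - Complex.exp (-h + t * Complex.I)) := by
  have hpi : (2 * (Real.pi : ℂ)) ≠ 0 := by simp [Real.pi_ne_zero]
  have hA : MeasurableSet {b : Fin n → ℝ | wsum b ≤ m} :=
    measurableSet_le measurable_wsum measurable_const
  have hprod : ∀ t : ℝ, ∫ b : Fin n → ℝ, Complex.exp ((-h + t * Complex.I) * (wsum b - m)) /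
      (1 - Complex.exp (-h + t * Complex.I)) ∂(bitsLaw n) =
      Complex.exp (-((-h + t * Complex.I) * m)) *
          (∏ i : Fin n, (1 + Complex.exp ((-h + t * Complex.I) * ((i : ℝ) + 1 : ℝ))) / 2) /
          (1 - Complex.exp (-h + t * Complex.I)) := by
    intro t
    have := integral_bits_prod (n := n)
      (fun i x => Complex.exp ((-h + t * Complex.I) * ((i : ℝ) + 1 : ℝ) * x))
    simp only [Complex.ofReal_zero, mul_zero, Complex.exp_zero, Complex.ofReal_one, mul_one,
      ← Complex.exp_sum] at this
    rw [integral_div, ← this, ← integral_const_mul]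
    congr 2
    ext b
    rw [← Complex.exp_add, wsum]
    congr 1
    push_cast
    simp only [mul_sub, Finset.mul_sum, ← mul_assoc]
    ring
  have hint : Integrable (Function.uncurry fun (t : ℝ) (b : Fin n → ℝ) =>
      Complex.exp ((-h + t * Complex.I) * (wsum b - m)) /
        (1 - Complex.exp (-h + t * Complex.I)))
      ((volume.restrict (uIoc (-Real.pi) Real.pi)).prod (bitsLaw n)) := by
    have hmeas : Measurable (Function.uncurry fun (t : ℝ) (b : Fin n → ℝ) =>
        Complex.exp ((-h + t * Complex.I) * (wsum b - m)) /
          (1 - Complex.exp (-h + t * Complex.I))) := by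
      have := measurable_wsum (n := n)
      simp only [Function.uncurry_def]
      fun_prop
    have : IsFiniteMeasure (volume.restrict (uIoc (-Real.pi) Real.pi)) := by
      rw [uIoc_of_le (by linarith [Real.pi_pos])]
      infer_instance
    -- The constant bound uses that the weighted sum is almost surely nonnegative.
    refine Integrable.mono' (g := fun _ => Real.exp (h * m) / (1 - Real.exp (-h)))
      (integrable_const _) hmeas.aestronglyMeasurable ?_
    have hae := (Measure.quasiMeasurePreserving_snd
      (μ := volume.restrict (uIoc (-Real.pi) Real.pi)) (ν := bitsLaw n)).ae (ae_bits n)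
    filter_upwards [hae] with ⟨t, b⟩ hb
    obtain ⟨s, hs⟩ := hb
    simp only at hs
    have hlt : Real.exp (-h) < 1 := Real.exp_lt_one_iff.2 (by linarith)
    simp only [Function.uncurry_apply_pair, norm_div]
    have h1 := norm_cexp_neg_add h t (wsum b - m)
    push_cast at h1
    rw [h1]
    refine div_le_div₀ (Real.exp_pos _).le (Real.exp_le_exp.2 ?_) (by linarith) ?_
    · rw [hs]
      have : (0 : ℝ) ≤ h * s := by positivity
      linarith
    · exact one_sub_exp_neg_le_norm t
  rw [eq_comm, div_mul_eq_mul_div, one_mul, div_eq_iff hpi]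
  simp only [← hprod]
  rw [intervalIntegral_integral_swap hint, ← integral_indicator_one hA, ← integral_complex_ofReal,
    ← integral_mul_const]
  refine integral_congr_ae ?_
  filter_upwards [ae_bits n] with b hb
  obtain ⟨s, hs⟩ := hb
  have := integral_cexp_div_one_sub hh s m
  rw [hs]
  simp only [Complex.ofReal_natCast]
  rw [this]
  simp only [indicator, mem_ofPred_eq, hs, Nat.cast_le]
  split_ifs <;> simp

/-! ### Bernoulli characteristic functions and products -/

/-- The characteristic function of a Bernoulli variable with success probability `p`. -/
def bernChar (p u : ℝ) : ℂ := 1 - p + p * Complex.exp (u * Complex.I)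

lemma normSq_bernChar (p u : ℝ) :
    Complex.normSq (bernChar p u) = 1 - 2 * (p * (1 - p)) * (1 - Real.cos u) := by
  have h : bernChar p u = ((1 - p + p * Real.cos u : ℝ) : ℂ) + (p * Real.sin u : ℝ) * Complex.I := by
    rw [bernChar, Complex.exp_mul_I]
    push_cast
    ring
  rw [h, Complex.normSq_add_mul_I]
  linear_combination p ^ 2 * Real.sin_sq_add_cos_sq u

/-- The squared modulus is 1 - 2p(1-p)(1 - cos u), and 1 + x ≤ e^x. -/
lemma norm_bernChar_le (p u : ℝ) :
    ‖bernChar p u‖ ≤ Real.exp (-(p * (1 - p) * (1 - Real.cos u))) := by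
  rw [← abs_of_pos (Real.exp_pos (-(p * (1 - p) * (1 - Real.cos u)))),
    ← abs_of_nonneg (norm_nonneg (bernChar p u)), ← sq_le_sq, ← Complex.normSq_eq_norm_sq,
    normSq_bernChar, ← Real.exp_nat_mul]
  have := Real.add_one_le_exp (((2 : ℕ) : ℝ) * -(p * (1 - p) * (1 - Real.cos u)))
  push_cast at this ⊢
  linarith

lemma norm_bernChar_le_one {p : ℝ} (hp0 : 0 ≤ p) (hp1 : p ≤ 1) (u : ℝ) : ‖bernChar p u‖ ≤ 1 := by
  refine (norm_bernChar_le p u).trans (Real.exp_le_one_iff.2 (neg_nonpos.2 ?_))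
  exact mul_nonneg (mul_nonneg hp0 (by linarith)) (by linarith [Real.cos_le_one u])

lemma norm_cexp_mul_I_sub_le {v : ℝ} (hv : |v| ≤ 1) :
    ‖Complex.exp (v * Complex.I) - (1 + v * Complex.I - v ^ 2 / 2)‖ ≤ 3 * |v| ^ 3 := by
  have h := Complex.norm_exp_sub_sum_le_norm_mul_exp (v * Complex.I) 3
  simp only [Finset.sum_range_succ, Finset.sum_range_zero, Nat.factorial] at h
  have hn : ‖(v : ℂ) * Complex.I‖ = |v| := by simp
  rw [hn] at h
  have he : Real.exp |v| ≤ 3 :=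
    (Real.exp_le_exp.2 hv).trans (by linarith [Real.exp_one_lt_d9])
  refine le_trans (le_of_eq ?_) (h.trans ?_)
  · congr 2
    push_cast
    linear_combination (-(v : ℂ) ^ 2 / 2) * Complex.I_sq
  · rw [mul_comm]
    gcongr

lemma abs_exp_neg_sub_le {y : ℝ} (hy0 : 0 ≤ y) (hy1 : y ≤ 1) :
    |Real.exp (-y) - (1 - y)| ≤ y ^ 2 := by
  have := Real.norm_exp_sub_one_sub_id_le (x := -y) (by simpa [abs_of_nonneg hy0] using hy1)
  rw [Real.norm_eq_abs, Real.norm_eq_abs, abs_neg, abs_of_nonneg hy0] at this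
  convert this using 2
  ring

/-- The centred function is p e^{i(1-p)u} + (1-p) e^{-ipu}. In its expansion the linear terms cancel
and the quadratic ones give p(1-p)u²/2. The constant is 7 = 3 + 3 + 1: two Taylor remainders and one
from the Gaussian. -/
lemma norm_bernChar_centered_sub_le {p u : ℝ} (hp0 : 0 ≤ p) (hp1 : p ≤ 1) (hu : |u| ≤ 1) :
    ‖bernChar p u * Complex.exp (-(p * u * Complex.I)) -
      (Real.exp (-(p * (1 - p) * u ^ 2 / 2)) : ℝ)‖ ≤ 7 * |u| ^ 3 := by
  have habs : ∀ q : ℝ, 0 ≤ q → q ≤ 1 → |q * u| ≤ |u| := by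
    intro q h0 h1
    rw [abs_mul, abs_of_nonneg h0]
    exact mul_le_of_le_one_left (abs_nonneg u) h1
  have h1 := norm_cexp_mul_I_sub_le (v := (1 - p) * u)
    ((habs _ (by linarith) (by linarith)).trans hu)
  have h2 := norm_cexp_mul_I_sub_le (v := (-p) * u) (by
    rw [neg_mul, abs_neg]; exact (habs _ hp0 hp1).trans hu)
  have hq0 : 0 ≤ p * (1 - p) := mul_nonneg hp0 (by linarith)
  have hq1 : p * (1 - p) ≤ 1 := by nlinarith
  have hu2 : u ^ 2 ≤ 1 := by rw [← sq_abs]; exact pow_le_one₀ (abs_nonneg u) hu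
  have hy1 : p * (1 - p) * u ^ 2 / 2 ≤ u ^ 2 := by nlinarith [sq_nonneg u]
  have hy0 : 0 ≤ p * (1 - p) * u ^ 2 / 2 := by positivity
  have h3 := abs_exp_neg_sub_le hy0 (by linarith)
  have h3' : |Real.exp (-(p * (1 - p) * u ^ 2 / 2)) - (1 - p * (1 - p) * u ^ 2 / 2)|
      ≤ |u| ^ 3 := by
    refine h3.trans ((pow_le_pow_left₀ hy0 hy1 2).trans ?_)
    rw [← sq_abs u, ← pow_mul]
    exact pow_le_pow_of_le_one (abs_nonneg u) hu (by norm_num)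
  rw [← Real.norm_eq_abs, ← Complex.norm_real] at h3'
  have hdec : bernChar p u * Complex.exp (-(p * u * Complex.I)) -
      (Real.exp (-(p * (1 - p) * u ^ 2 / 2)) : ℝ) =
      (p : ℂ) * (Complex.exp (((1 - p) * u : ℝ) * Complex.I) -
        (1 + ((1 - p) * u : ℝ) * Complex.I - ((1 - p) * u : ℝ) ^ 2 / 2)) +
      ((1 - p : ℝ) : ℂ) * (Complex.exp (((-p) * u : ℝ) * Complex.I) -
        (1 + ((-p) * u : ℝ) * Complex.I - ((-p) * u : ℝ) ^ 2 / 2)) -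
      ((Real.exp (-(p * (1 - p) * u ^ 2 / 2)) - (1 - p * (1 - p) * u ^ 2 / 2) : ℝ) : ℂ) := by
    have e1 : Complex.exp (((1 - p) * u : ℝ) * Complex.I) =
        Complex.exp (u * Complex.I) * Complex.exp (-(p * u * Complex.I)) := by
      rw [← Complex.exp_add]; congr 1; push_cast; ring
    have e2 : Complex.exp (((-p) * u : ℝ) * Complex.I) = Complex.exp (-(p * u * Complex.I)) := by
      congr 1; push_cast; ring
    rw [e1, e2, bernChar]
    push_cast
    ring
  rw [hdec]
  have hp : ‖(p : ℂ)‖ ≤ 1 := by rw [Complex.norm_real, Real.norm_eq_abs, abs_of_nonneg hp0]; exact hp1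
  have hp' : ‖((1 - p : ℝ) : ℂ)‖ ≤ 1 := by
    rw [Complex.norm_real, Real.norm_eq_abs, abs_of_nonneg (by linarith)]; linarith
  have hc1 : |(1 - p) * u| ^ 3 ≤ |u| ^ 3 :=
    pow_le_pow_left₀ (abs_nonneg _) (habs _ (by linarith) (by linarith)) 3
  have hc2 : |(-p) * u| ^ 3 ≤ |u| ^ 3 :=
    pow_le_pow_left₀ (abs_nonneg _) (by rw [neg_mul, abs_neg]; exact habs _ hp0 hp1) 3
  refine (norm_sub_le _ _).trans ((add_le_add (norm_add_le _ _) h3').trans ?_)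
  rw [norm_mul, norm_mul]
  have k1 := mul_le_mul hp h1 (norm_nonneg _) zero_le_one
  have k2 := mul_le_mul hp' h2 (norm_nonneg _) zero_le_one
  linarith

lemma norm_prod_sub_prod_le_sum {ι R : Type*} [NormedCommRing R] [NormOneClass R] (s : Finset ι)
    {f g : ι → R} (hf : ∀ i ∈ s, ‖f i‖ ≤ 1) (hg : ∀ i ∈ s, ‖g i‖ ≤ 1) :
    ‖∏ i ∈ s, f i - ∏ i ∈ s, g i‖ ≤ ∑ i ∈ s, ‖f i - g i‖ := by
  classical
  induction s using Finset.induction_on with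
  | empty => simp
  | insert a s ha ih =>
    rw [Finset.prod_insert ha, Finset.prod_insert ha, Finset.sum_insert ha]
    have ih' := ih (fun i hi => hf i (Finset.mem_insert_of_mem hi))
      (fun i hi => hg i (Finset.mem_insert_of_mem hi))
    have hgp : ‖∏ i ∈ s, g i‖ ≤ 1 := by
      refine (Finset.norm_prod_le _ _).trans (Finset.prod_le_one (fun _ _ => norm_nonneg _) ?_)
      exact fun i hi => hg i (Finset.mem_insert_of_mem hi)
    have hdec : f a * ∏ i ∈ s, f i - g a * ∏ i ∈ s, g i =
        (f a - g a) * ∏ i ∈ s, g i + f a * (∏ i ∈ s, f i - ∏ i ∈ s, g i) := by ring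
    rw [hdec]
    refine (norm_add_le _ _).trans (add_le_add ?_ ?_)
    · exact (norm_mul_le _ _).trans (mul_le_of_le_one_right (norm_nonneg _) hgp)
    · exact (norm_mul_le _ _).trans ((mul_le_of_le_one_left (norm_nonneg _)
        (hf a (Finset.mem_insert_self a s))).trans ih')

/-! ### Lower bounds for the sum of 1 - cos(kt) -/

lemma two_mul_sin_half_mul_sum_cos (t : ℝ) (n : ℕ) :
    2 * Real.sin (t / 2) * ∑ k ∈ Finset.range n, Real.cos (((k : ℝ) + 1) * t) =
      Real.sin ((n + 1 / 2) * t) - Real.sin (t / 2) := by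
  induction n with
  | zero => simp; ring_nf
  | succ n ih =>
    rw [Finset.sum_range_succ, mul_add, ih]
    have h1 : ((n + 1 : ℕ) + 1 / 2 : ℝ) * t = ((n : ℝ) + 1) * t + t / 2 := by push_cast; ring
    have h2 : ((n : ℝ) + 1 / 2 : ℝ) * t = ((n : ℝ) + 1) * t - t / 2 := by ring
    rw [h1, h2, Real.sin_add, Real.sin_sub]
    ring

/-- The Dirichlet kernel identity bounds 2 sin(t/2) times the cosine sum by 1, and Jordan's
inequality gives sin(t/2) ≥ t/π ≥ 1/n. So the cosine sum is at most n/2. -/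
lemma half_le_sum_one_sub_cos_of_pos {n : ℕ} (hn : 1 ≤ n) {t : ℝ} (ht : Real.pi / n ≤ t)
    (ht' : t ≤ Real.pi) : (n : ℝ) / 2 ≤ ∑ i : Fin n, (1 - Real.cos (((i : ℝ) + 1) * t)) := by
  have hn0 : (0 : ℝ) < n := by exact_mod_cast hn
  have hpi := Real.pi_pos
  have ht0 : 0 < t := lt_of_lt_of_le (by positivity) ht
  rw [Fin.sum_univ_eq_sum_range (fun k => 1 - Real.cos (((k : ℝ) + 1) * t)) n,
    Finset.sum_sub_distrib]
  simp only [Finset.sum_const, Finset.card_range, nsmul_eq_mul, mul_one]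
  set A := ∑ k ∈ Finset.range n, Real.cos (((k : ℝ) + 1) * t)
  have hA := two_mul_sin_half_mul_sum_cos t n
  have hs : t / Real.pi ≤ Real.sin (t / 2) := by
    have := Real.mul_le_sin (x := t / 2) (by linarith) (by linarith)
    refine le_trans (le_of_eq ?_) this
    field_simp
  have hs0 : 0 < Real.sin (t / 2) := lt_of_lt_of_le (by positivity) hs
  have hns : 1 ≤ n * Real.sin (t / 2) := by
    have h1 : 1 / (n : ℝ) ≤ t / Real.pi := by
      rw [div_le_div_iff₀ hn0 hpi]
      rw [div_le_iff₀ hn0] at ht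
      linarith
    have := mul_le_mul_of_nonneg_left (h1.trans hs) hn0.le
    rwa [mul_one_div_cancel hn0.ne'] at this
  have h2 : 2 * Real.sin (t / 2) * A ≤ 2 * Real.sin (t / 2) * (n / 2) := by
    have : 2 * Real.sin (t / 2) * A ≤ 1 := by
      rw [hA]
      linarith [Real.sin_le_one ((n + 1 / 2) * t)]
    linarith
  have := le_of_mul_le_mul_left h2 (by positivity)
  linarith

lemma half_le_sum_one_sub_cos {n : ℕ} (hn : 1 ≤ n) {t : ℝ} (ht : Real.pi / n ≤ |t|)
    (ht' : |t| ≤ Real.pi) : (n : ℝ) / 2 ≤ ∑ i : Fin n, (1 - Real.cos (((i : ℝ) + 1) * t)) := by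
  refine (half_le_sum_one_sub_cos_of_pos hn ht ht').trans (le_of_eq ?_)
  refine Finset.sum_congr rfl fun i _ => ?_
  rw [← Real.cos_abs (((i : ℝ) + 1) * t), abs_mul, abs_of_pos (by positivity : (0 : ℝ) < i + 1)]

lemma cube_div_three_le_sum_sq (n : ℕ) :
    (n : ℝ) ^ 3 / 3 ≤ ∑ i : Fin n, ((i : ℝ) + 1) ^ 2 := by
  rw [Fin.sum_univ_eq_sum_range (fun k => ((k : ℝ) + 1) ^ 2) n]
  induction n with
  | zero => simp
  | succ n ih =>
    rw [Finset.sum_range_succ]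
    push_cast
    have : (0 : ℝ) ≤ n := Nat.cast_nonneg n
    linarith [mul_nonneg this this]

/-- Every angle kt stays in [-π, π], where 1 - cos x ≥ 2x²/π²; then sum the squares. -/
lemma sq_le_sum_one_sub_cos {n : ℕ} (hn : 1 ≤ n) {t : ℝ} (ht : |t| ≤ Real.pi / n) :
    2 / (3 * Real.pi ^ 2) * ((n : ℝ) ^ 3 * t ^ 2) ≤
      ∑ i : Fin n, (1 - Real.cos (((i : ℝ) + 1) * t)) := by
  have hn0 : (0 : ℝ) < n := by exact_mod_cast hn
  have hterm : ∀ i ∈ (Finset.univ : Finset (Fin n)),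
      2 / Real.pi ^ 2 * t ^ 2 * ((i : ℝ) + 1) ^ 2 ≤ 1 - Real.cos (((i : ℝ) + 1) * t) := by
    intro i _
    have hi : (i : ℝ) + 1 ≤ n := by exact_mod_cast i.2
    have h := Real.cos_le_one_sub_mul_cos_sq (x := ((i : ℝ) + 1) * t) (by
      rw [abs_mul, abs_of_pos (by positivity : (0 : ℝ) < i + 1)]
      calc ((i : ℝ) + 1) * |t| ≤ n * (Real.pi / n) := by gcongr
        _ = Real.pi := by field_simp)
    rw [mul_pow] at h
    linarith
  refine le_trans ?_ (Finset.sum_le_sum hterm)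
  rw [← Finset.mul_sum]
  have := mul_le_mul_of_nonneg_left (cube_div_three_le_sum_sq n)
    (by positivity : 0 ≤ 2 / Real.pi ^ 2 * t ^ 2)
  refine le_trans (le_of_eq ?_) this
  field_simp

/-! ### The tilted characteristic function: domination and Gaussian limit -/

/-- The characteristic function of `∑ i B_i` under the exponentially tilted law. -/
def tiltChar (n : ℕ) (θ t : ℝ) : ℂ :=
  ∏ i : Fin n, bernChar (sigmoid (-(θ * (((i : ℝ) + 1) / n)))) (((i : ℝ) + 1) * t)

lemma continuous_tiltChar (n : ℕ) (θ : ℝ) : Continuous (tiltChar n θ) := by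
  unfold tiltChar bernChar
  fun_prop

/-- Factor by factor, (1 + e^{-y+iu})/2 is (1 + e^{-y})/2 times the characteristic function of a
Bernoulli variable with parameter σ(-y). -/
lemma prod_eq_tiltChar {n : ℕ} (hn : 1 ≤ n) (θ t : ℝ) :
    ∏ i : Fin n, (1 + Complex.exp ((-(θ / n : ℝ) + t * Complex.I) * ((i : ℝ) + 1 : ℝ))) / 2 =
      (Real.exp (sumCGF n θ) : ℝ) * tiltChar n θ t := by
  rw [sumCGF, Real.exp_sum, Complex.ofReal_prod, tiltChar, ← Finset.prod_mul_distrib]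
  refine Finset.prod_congr rfl fun i _ => ?_
  set x : ℝ := ((i : ℝ) + 1) / n with hx
  have hn0 : (n : ℝ) ≠ 0 := by positivity
  have e1 : Complex.exp ((-(θ / n : ℝ) + t * Complex.I) * ((i : ℝ) + 1 : ℝ)) =
      (Real.exp (-(θ * x)) : ℝ) * Complex.exp ((((i : ℝ) + 1) * t : ℝ) * Complex.I) := by
    rw [Complex.ofReal_exp, ← Complex.exp_add, hx]
    congr 1
    push_cast
    ring
  have e2 : Real.exp (bitCGF (θ * x)) = (1 + Real.exp (-(θ * x))) / 2 := by
    rw [bitCGF, Real.exp_log (by positivity)]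
  have hpos := Real.exp_pos (-(θ * x))
  have e3 : (1 + Real.exp (-(θ * x))) * sigmoid (-(θ * x)) = Real.exp (-(θ * x)) := by
    rw [← Real.sigmoid_mul_rexp_neg, Real.sigmoid_def]
    field_simp
  have e3' : (1 + (Real.exp (-(θ * x)) : ℂ)) * (sigmoid (-(θ * x)) : ℝ) = Real.exp (-(θ * x)) := by
    exact_mod_cast congrArg (fun y : ℝ => (y : ℂ)) e3
  rw [e1, e2, bernChar]
  push_cast at e3' ⊢
  linear_combination (1 / 2 - Complex.exp ((↑↑i + 1) * t * Complex.I) / 2) * e3'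

/-- The standard deviation scale `n^{3/2}` of `∑ i B_i`. -/
def scale (n : ℕ) : ℝ := n * √n

/-- The mean of `∑ i B_i` under the exponentially tilted law. -/
def tiltMean (n : ℕ) (θ : ℝ) : ℝ :=
  ∑ i : Fin n, ((i : ℝ) + 1) * sigmoid (-(θ * (((i : ℝ) + 1) / n)))

/-- The normalized variance of `∑ i B_i` under the exponentially tilted law. -/
def tiltVar (n : ℕ) (θ : ℝ) : ℝ :=
  ∑ i : Fin n, ((i : ℝ) + 1) / n * (((i : ℝ) + 1) / n *
        (sigmoid (θ * (((i : ℝ) + 1) / n)) * sigmoid (-(θ * (((i : ℝ) + 1) / n)))))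

lemma scale_pos {n : ℕ} (hn : 1 ≤ n) : 0 < scale n := by
  have : (0 : ℝ) < n := by exact_mod_cast hn
  unfold scale
  positivity

lemma cube_mul_div_scale_sq {n : ℕ} (hn : 1 ≤ n) (s : ℝ) :
    (n : ℝ) ^ 3 * (s / scale n) ^ 2 = s ^ 2 := by
  have hn0 : (0 : ℝ) < n := by exact_mod_cast hn
  rw [scale, div_pow, mul_pow, Real.sq_sqrt hn0.le]
  field_simp

lemma mul_div_scale {n : ℕ} (hn : 1 ≤ n) (s : ℝ) : n * (s / scale n) = s / √n := by
  have hn0 : (0 : ℝ) < n := by exact_mod_cast hn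
  rw [scale]
  field_simp

/-- For 0 ≤ θ ≤ b each tilted parameter p satisfies σ(-b) ≤ p ≤ 1/2, so p(1-p) ≥ σ(-b)/2. -/
lemma norm_tiltChar_le_exp {b θ : ℝ} (hθ0 : 0 ≤ θ) (hθb : θ ≤ b) {n : ℕ} (hn : 1 ≤ n) (t : ℝ) :
    ‖tiltChar n θ t‖ ≤
      Real.exp (-(sigmoid (-b) / 2 * ∑ i : Fin n, (1 - Real.cos (((i : ℝ) + 1) * t)))) := by
  rw [Finset.mul_sum, ← Finset.sum_neg_distrib, Real.exp_sum, tiltChar]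
  refine (Finset.norm_prod_le _ _).trans (Finset.prod_le_prod (fun _ _ => norm_nonneg _) ?_)
  intro i _
  refine (norm_bernChar_le _ _).trans (Real.exp_le_exp.2 (neg_le_neg ?_))
  have hn0 : (0 : ℝ) < n := by exact_mod_cast hn
  have hi : (i : ℝ) + 1 ≤ n := by exact_mod_cast i.2
  have hx0 : 0 ≤ ((i : ℝ) + 1) / n := by positivity
  have hx1 : ((i : ℝ) + 1) / n ≤ 1 := (div_le_one hn0).2 hi
  refine mul_le_mul_of_nonneg_right ?_ (by linarith [Real.cos_le_one (((i : ℝ) + 1) * t)])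
  have h1 : sigmoid (-b) ≤ sigmoid (-(θ * (((i : ℝ) + 1) / n))) :=
    Real.sigmoid_le (neg_le_neg ((mul_le_of_le_one_right hθ0 hx1).trans hθb))
  have h2 : 1 / 2 ≤ 1 - sigmoid (-(θ * (((i : ℝ) + 1) / n))) := by
    rw [Real.sigmoid_neg, sub_sub_cancel, one_div, ← Real.sigmoid_zero]
    exact Real.sigmoid_le (mul_nonneg hθ0 hx0)
  have := mul_le_mul h1 h2 (by norm_num) (Real.sigmoid_pos _).le
  linarith

lemma exists_norm_tiltChar_le (b : ℝ) :
    ∃ C, 0 ≤ C ∧ ∀ θ ∈ Icc 0 b, ∀ n : ℕ, 1 ≤ n → ∀ s : ℝ, |s| ≤ Real.pi * scale n →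
      ‖tiltChar n θ (s / scale n)‖ ≤ C / (1 + s ^ 2) := by
  have hpi := Real.pi_pos
  set c := sigmoid (-b) / 2 with hc
  have hc0 : 0 < c := half_pos (Real.sigmoid_pos _)
  set κ := c * (2 / (3 * Real.pi ^ 2)) with hκ
  have hκ0 : 0 < κ := by positivity
  -- One summand for each range of t below; 48 = 6·2³ comes from x³/6 ≤ e^x at x = cn/2.
  refine ⟨(1 + 1 / κ) + 48 * (1 + Real.pi ^ 2) / c ^ 3, by positivity, ?_⟩
  intro θ hθ n hn s hs
  have hn0 : (0 : ℝ) < n := by exact_mod_cast hn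
  have hn1 : (1 : ℝ) ≤ n := by exact_mod_cast hn
  have hT := scale_pos hn
  have hmain := norm_tiltChar_le_exp hθ.1 hθ.2 hn (s / scale n)
  rw [← hc] at hmain
  refine hmain.trans ?_
  rw [le_div_iff₀ (by positivity)]
  rcases le_total |s / scale n| (Real.pi / n) with ht | ht
  -- Near zone |t| ≤ π/n: the decay is at least e^{-κs²}, weakened to 1/(1 + κs²).
  · have h1 := mul_le_mul_of_nonneg_left (sq_le_sum_one_sub_cos hn ht) hc0.le
    rw [cube_mul_div_scale_sq hn, ← mul_assoc, ← hκ] at h1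
    have h2 : Real.exp (-(c * ∑ i : Fin n, (1 - Real.cos (((i : ℝ) + 1) * (s / scale n))))) ≤
        (1 + κ * s ^ 2)⁻¹ := by
      rw [Real.exp_neg]
      refine inv_anti₀ (by positivity) ?_
      have := Real.add_one_le_exp (κ * s ^ 2)
      linarith [Real.exp_le_exp.2 h1]
    have h3 : 0 ≤ 48 * (1 + Real.pi ^ 2) / c ^ 3 := by positivity
    have h4 : (1 + κ * s ^ 2)⁻¹ * (1 + s ^ 2) ≤ 1 + 1 / κ := by
      rw [inv_mul_le_iff₀ (by positivity)]
      have : (1 + κ * s ^ 2) * (1 + 1 / κ) = 1 + s ^ 2 + (1 / κ + κ * s ^ 2) := by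
        field_simp; ring
      rw [this]
      have : 0 ≤ 1 / κ + κ * s ^ 2 := by positivity
      linarith
    have := mul_le_mul_of_nonneg_right h2 (by positivity : 0 ≤ 1 + s ^ 2)
    linarith
  -- Far zone: the decay e^{-cn/2} beats 1 + s², which is at most of order n³.
  · have ht' : |s / scale n| ≤ Real.pi := by
      rw [abs_div, abs_of_pos hT, div_le_iff₀ hT]
      exact hs
    have h1 := mul_le_mul_of_nonneg_left (half_le_sum_one_sub_cos hn ht ht') hc0.le
    have hx0 : 0 < c * (n / 2) := by positivity
    have h2 : Real.exp (-(c * ∑ i : Fin n, (1 - Real.cos (((i : ℝ) + 1) * (s / scale n))))) ≤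
        ((c * (n / 2)) ^ 3 / 6)⁻¹ := by
      rw [Real.exp_neg]
      refine inv_anti₀ (by positivity) ?_
      have := Real.pow_div_factorial_le_exp _ hx0.le 3
      norm_num [Nat.factorial] at this
      linarith [Real.exp_le_exp.2 h1]
    have h3 : 1 + s ^ 2 ≤ (1 + Real.pi ^ 2) * n ^ 3 := by
      have h4 : s ^ 2 ≤ Real.pi ^ 2 * n ^ 3 := by
        rw [← sq_abs]
        refine (pow_le_pow_left₀ (abs_nonneg s) hs 2).trans (le_of_eq ?_)
        rw [scale, mul_pow, mul_pow, Real.sq_sqrt hn0.le]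
        ring
      have h5 : (1 : ℝ) ≤ n ^ 3 := one_le_pow₀ hn1
      linarith
    have h6 := mul_le_mul h2 h3 (by positivity) (by positivity)
    refine h6.trans ?_
    have : ((c * ((n : ℝ) / 2)) ^ 3 / 6)⁻¹ * ((1 + Real.pi ^ 2) * n ^ 3) =
        48 * (1 + Real.pi ^ 2) / c ^ 3 := by
      field_simp
      norm_num
    rw [this]
    have : 0 ≤ 1 + 1 / κ := by positivity
    linarith

/-- Replace the factors by Gaussians one at a time. Each angle is at most |s|/√n in modulus, so n
errors of size 7(|s|/√n)³ add up to the bound. -/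
lemma norm_tiltChar_centered_sub_le {n : ℕ} (hn : 1 ≤ n) (θ : ℝ) {s : ℝ} (hs : |s| ≤ √n) :
    ‖tiltChar n θ (s / scale n) *
        Complex.exp (-((tiltMean n θ * (s / scale n) : ℝ) * Complex.I)) -
      (Real.exp (-(s ^ 2 / 2 * (tiltVar n θ / n))) : ℝ)‖ ≤ 7 * |s| ^ 3 / √n := by
  have hn0 : (0 : ℝ) < n := by exact_mod_cast hn
  have hr0 : 0 < √(n : ℝ) := Real.sqrt_pos.2 hn0
  set t := s / scale n with ht
  have hnt : n * |t| = |s| / √n := by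
    have := mul_div_scale hn |s|
    rw [← this, ht, abs_div, abs_of_pos (scale_pos hn)]
  set p : Fin n → ℝ := fun i => sigmoid (-(θ * (((i : ℝ) + 1) / n))) with hp
  have hp0 : ∀ i, 0 ≤ p i := fun i => (Real.sigmoid_pos _).le
  have hp1 : ∀ i, p i ≤ 1 := fun i => (Real.sigmoid_lt_one _).le
  have e1 : Complex.exp (-((tiltMean n θ * t : ℝ) * Complex.I)) =
      ∏ i : Fin n, Complex.exp (-(p i * (((i : ℝ) + 1) * t : ℝ) * Complex.I)) := by
    rw [← Complex.exp_sum, tiltMean]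
    congr 1
    push_cast
    rw [Finset.sum_mul, Finset.sum_mul, ← Finset.sum_neg_distrib]
    refine Finset.sum_congr rfl fun i _ => ?_
    simp only [hp]
    ring
  have e2 : ((Real.exp (-(s ^ 2 / 2 * (tiltVar n θ / n))) : ℝ) : ℂ) =
      ∏ i : Fin n, ((Real.exp (-(p i * (1 - p i) * (((i : ℝ) + 1) * t) ^ 2 / 2)) : ℝ) : ℂ) := by
    rw [← Complex.ofReal_prod, ← Real.exp_sum]
    congr 2
    rw [tiltVar, Finset.sum_div, Finset.mul_sum, ← Finset.sum_neg_distrib]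
    refine Finset.sum_congr rfl fun i _ => ?_
    rw [← cube_mul_div_scale_sq hn s, ← ht]
    simp only [hp]
    rw [show sigmoid (θ * (((i : ℝ) + 1) / n)) = 1 - sigmoid (-(θ * (((i : ℝ) + 1) / n))) by
      rw [Real.sigmoid_neg, sub_sub_cancel]]
    field_simp
  rw [e1, e2, tiltChar, ← Finset.prod_mul_distrib]
  have hk : ∀ i : Fin n, |((i : ℝ) + 1) * t| ≤ |s| / √n := by
    intro i
    have hi : (i : ℝ) + 1 ≤ n := by exact_mod_cast i.2
    rw [abs_mul, abs_of_pos (by positivity : (0 : ℝ) < i + 1), ← hnt]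
    gcongr
  have hs1 : |s| / √n ≤ 1 := (div_le_one hr0).2 hs
  refine (norm_prod_sub_prod_le_sum _ ?_ ?_).trans ?_
  · intro i _
    rw [norm_mul]
    have : ‖Complex.exp (-(p i * (((i : ℝ) + 1) * t : ℝ) * Complex.I))‖ = 1 := by
      rw [Complex.norm_exp]
      simp
    rw [this, mul_one]
    exact norm_bernChar_le_one (hp0 i) (hp1 i) _
  · intro i _
    rw [Complex.norm_real, Real.norm_eq_abs, abs_of_pos (Real.exp_pos _), Real.exp_le_one_iff]
    have := mul_nonneg (hp0 i) (sub_nonneg.2 (hp1 i))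
    have : 0 ≤ p i * (1 - p i) * (((i : ℝ) + 1) * t) ^ 2 / 2 := by positivity
    linarith
  · have hterm : ∀ i ∈ (Finset.univ : Finset (Fin n)),
        ‖bernChar (p i) (((i : ℝ) + 1) * t) *
            Complex.exp (-(p i * (((i : ℝ) + 1) * t : ℝ) * Complex.I)) -
          ((Real.exp (-(p i * (1 - p i) * (((i : ℝ) + 1) * t) ^ 2 / 2)) : ℝ) : ℂ)‖ ≤
        7 * (|s| / √n) ^ 3 := by
      intro i _
      refine (norm_bernChar_centered_sub_le (hp0 i) (hp1 i) ((hk i).trans hs1)).trans ?_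
      have := hk i
      gcongr
    refine (Finset.sum_le_sum hterm).trans (le_of_eq ?_)
    simp only [Finset.sum_const, Finset.card_univ, Fintype.card_fin, nsmul_eq_mul]
    rw [div_pow]
    nth_rewrite 1 [← Real.sq_sqrt hn0.le]
    field_simp

/-! ### The rescaled saddlepoint integrand and its limit -/

/-- The integer threshold `⌊n² d⌋` for `d = -K̃'(θ)`. -/
def cutoff (n : ℕ) (θ : ℝ) : ℕ := ⌊(n : ℝ) ^ 2 * -intCGF' θ⌋₊

/-- The rescaled saddlepoint integrand on the line `Re w = -θ / n`. -/
def kernel (n : ℕ) (θ s : ℝ) : ℂ :=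
  tiltChar n θ (s / scale n) * Complex.exp (-((cutoff n θ * (s / scale n) : ℝ) * Complex.I)) *
    ((θ / n : ℝ) / (1 - Complex.exp (-(θ / n : ℝ) + (s / scale n : ℝ) * Complex.I)))

/-- The rescaled saddlepoint integrand, cut off to one period. -/
def cutKernel (n : ℕ) (θ : ℝ) : ℝ → ℂ :=
  (Ioc (-(Real.pi * scale n)) (Real.pi * scale n)).indicator (kernel n θ)

lemma intCGF'_nonpos (θ : ℝ) : intCGF' θ ≤ 0 := by
  have h : 0 ≤ ∫ x in (0 : ℝ)..1, -(x * -sigmoid (-(θ * x))) :=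
    intervalIntegral.integral_nonneg zero_le_one fun x hx => by
      have := mul_nonneg hx.1 (Real.sigmoid_nonneg (-(θ * x)))
      linarith
  rw [intervalIntegral.integral_neg] at h
  exact neg_nonneg.1 h

lemma abs_cutoff_sub_le (n : ℕ) (θ : ℝ) :
    |(cutoff n θ : ℝ) - (n : ℝ) ^ 2 * -intCGF' θ| ≤ 1 := by
  have h0 : 0 ≤ (n : ℝ) ^ 2 * -intCGF' θ := by
    have := intCGF'_nonpos θ
    exact mul_nonneg (by positivity) (by linarith)
  have h1 := Nat.floor_le h0
  have h2 := Nat.lt_floor_add_one ((n : ℝ) ^ 2 * -intCGF' θ)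
  rw [cutoff, abs_le]
  constructor <;> linarith

/-- Convergence along `atTop ×ˢ 𝓟 S` is uniform convergence on S, so a bound depending on n alone
suffices. -/
lemma tendsto_zero_of_le {E : Type*} [SeminormedAddCommGroup E] {S : Set ℝ} {f : ℕ × ℝ → E}
    {g : ℕ → ℝ} {N : ℕ} (h : ∀ n, N ≤ n → ∀ θ ∈ S, ‖f (n, θ)‖ ≤ g n)
    (hg : Tendsto g atTop (𝓝 0)) : Tendsto f (atTop ×ˢ 𝓟 S) (𝓝 0) := by
  have hg' : Tendsto (fun p : ℕ × ℝ => g p.1) (atTop ×ˢ 𝓟 S) (𝓝 0) := hg.comp tendsto_fst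
  have hev : ∀ᶠ p : ℕ × ℝ in atTop ×ˢ 𝓟 S, ‖f p‖ ≤ g p.1 := by
    rw [eventually_prod_principal_iff]
    exact (eventually_ge_atTop N).mono fun n hn θ hθ => h n hn θ hθ
  exact squeeze_zero_norm' hev hg'

lemma tendsto_const_div_sqrt (C : ℝ) : Tendsto (fun n : ℕ => C / √(n : ℝ)) atTop (𝓝 0) :=
  (Real.tendsto_sqrt_atTop.comp tendsto_natCast_atTop_atTop).const_div_atTop C

lemma tendsto_tiltChar_centered (S : Set ℝ) (s : ℝ) :
    Tendsto (fun p : ℕ × ℝ => tiltChar p.1 p.2 (s / scale p.1) *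
        Complex.exp (-((tiltMean p.1 p.2 * (s / scale p.1) : ℝ) * Complex.I)) -
      (Real.exp (-(s ^ 2 / 2 * (tiltVar p.1 p.2 / p.1))) : ℝ)) (atTop ×ˢ 𝓟 S) (𝓝 0) := by
  refine tendsto_zero_of_le (N := max 1 ⌈s ^ 2⌉₊) (fun n hn θ _ => ?_)
    (tendsto_const_div_sqrt (7 * |s| ^ 3))
  refine norm_tiltChar_centered_sub_le (le_of_max_le_left hn) θ (Real.abs_le_sqrt ?_)
  exact Nat.ceil_le.1 (le_of_max_le_right hn)

lemma abs_exp_neg_sub_exp_neg_le {x y : ℝ} (hx : 0 ≤ x) (hy : 0 ≤ y) :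
    |Real.exp (-x) - Real.exp (-y)| ≤ |x - y| := by
  wlog hxy : x ≤ y generalizing x y
  · rw [abs_sub_comm, abs_sub_comm x]
    exact this hy hx (le_of_not_ge hxy)
  have h1 : Real.exp (-y) ≤ Real.exp (-x) := Real.exp_le_exp.2 (by linarith)
  rw [abs_of_nonneg (by linarith), abs_of_nonpos (by linarith)]
  have h2 := Real.add_one_le_exp (-(y - x))
  have h3 : Real.exp (-y) = Real.exp (-x) * Real.exp (-(y - x)) := by
    rw [← Real.exp_add]; congr 1; ring
  have h4 : Real.exp (-x) ≤ 1 := Real.exp_le_one_iff.2 (by linarith)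
  rw [h3]
  nlinarith [Real.exp_pos (-x)]

lemma tiltVar_nonneg (n : ℕ) (θ : ℝ) : 0 ≤ tiltVar n θ :=
  Finset.sum_nonneg fun i _ => by
    have := Real.sigmoid_nonneg (θ * (((i : ℝ) + 1) / n))
    have := Real.sigmoid_nonneg (-(θ * (((i : ℝ) + 1) / n)))
    positivity

lemma tendsto_exp_tiltVar {S : Set ℝ} (hS : IsCompact S) (s : ℝ) :
    Tendsto (fun p : ℕ × ℝ => ((Real.exp (-(s ^ 2 / 2 * (tiltVar p.1 p.2 / p.1))) : ℝ) : ℂ) -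
      (Real.exp (-(s ^ 2 / 2 * intCGF'' p.2)) : ℝ)) (atTop ×ˢ 𝓟 S) (𝓝 0) := by
  obtain ⟨C, hC⟩ := exists_sum_variance_le hS
  refine tendsto_zero_of_le (N := 1) (g := fun n => (s ^ 2 / 2 * C) / (n : ℝ))
    (fun n hn θ hθ => ?_) (tendsto_const_div_atTop_nhds_zero_nat _)
  have hn0 : (0 : ℝ) < n := by exact_mod_cast hn
  simp only
  rw [← Complex.ofReal_sub, Complex.norm_real, Real.norm_eq_abs]
  refine (abs_exp_neg_sub_exp_neg_le ?_ ?_).trans ?_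
  · have := tiltVar_nonneg n θ
    positivity
  · have := (intCGF''_pos θ).le
    positivity
  · have := hC θ hθ n hn
    change |tiltVar n θ - n * intCGF'' θ| ≤ C at this
    rw [← mul_sub, abs_mul, abs_of_nonneg (by positivity), mul_div_assoc]
    gcongr
    rw [le_div_iff₀ hn0, ← abs_of_pos hn0, ← abs_mul, abs_of_pos hn0]
    refine le_trans (le_of_eq ?_) this
    congr 1
    field_simp

/-- The saddlepoint equation matches the tilted mean to the cutoff up to O(n), which is negligible
against the scale n^{3/2}. -/
lemma tendsto_exp_mean_sub_cutoff {S : Set ℝ} (hS : IsCompact S) (s : ℝ) :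
    Tendsto (fun p : ℕ × ℝ => Complex.exp
      (((tiltMean p.1 p.2 - cutoff p.1 p.2) * (s / scale p.1) : ℝ) * Complex.I))
      (atTop ×ˢ 𝓟 S) (𝓝 1) := by
  obtain ⟨C, hC⟩ := exists_sum_mean_le hS
  have h0 : Tendsto (fun p : ℕ × ℝ => (tiltMean p.1 p.2 - cutoff p.1 p.2) * (s / scale p.1))
      (atTop ×ˢ 𝓟 S) (𝓝 0) := by
    refine tendsto_zero_of_le (N := 1) (g := fun n => (|s| * (C + 1)) / √(n : ℝ))
      (fun n hn θ hθ => ?_) (tendsto_const_div_sqrt _)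
    have hn0 : (0 : ℝ) < n := by exact_mod_cast hn
    have hn1 : (1 : ℝ) ≤ n := by exact_mod_cast hn
    have h1 := hC θ hθ n hn
    have h2 := abs_cutoff_sub_le n θ
    have h3 : tiltMean n θ = -(n * ∑ i : Fin n,
        ((i : ℝ) + 1) / n * -sigmoid (-(θ * (((i : ℝ) + 1) / n)))) := by
      rw [tiltMean, Finset.mul_sum, ← Finset.sum_neg_distrib]
      refine Finset.sum_congr rfl fun i _ => ?_
      field_simp
    have h4 : |tiltMean n θ - cutoff n θ| ≤ n * (C + 1) := by
      have h5 : tiltMean n θ - cutoff n θ = -(n * (∑ i : Fin n,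
          ((i : ℝ) + 1) / n * -sigmoid (-(θ * (((i : ℝ) + 1) / n))) - n * intCGF' θ)) -
          (cutoff n θ - (n : ℝ) ^ 2 * -intCGF' θ) := by rw [h3]; ring
      rw [h5]
      refine (abs_sub _ _).trans ?_
      rw [abs_neg, abs_mul, abs_of_pos hn0]
      have := mul_le_mul_of_nonneg_left h1 hn0.le
      linarith
    simp only
    rw [Real.norm_eq_abs, abs_mul]
    have h6 : |s / scale n| = |s| / scale n := by rw [abs_div, abs_of_pos (scale_pos hn)]
    have h7 := mul_div_scale hn |s|
    calc |tiltMean n θ - cutoff n θ| * |s / scale n|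
        ≤ n * (C + 1) * |s / scale n| := by gcongr
      _ = (C + 1) * (n * (|s| / scale n)) := by rw [h6]; ring
      _ = |s| * (C + 1) / √n := by rw [h7]; ring
  have hc : Continuous fun x : ℝ => Complex.exp (x * Complex.I) := by fun_prop
  have h1 := (hc.tendsto 0).comp h0
  rwa [Complex.ofReal_zero, zero_mul, Complex.exp_zero] at h1

/-- With w = -h + it, 1 - e^w = h - it + O(|w|²). Here h is of order 1/n while t and |w|² are
O(n^{-3/2}), uniformly because θ ≥ a > 0. -/
lemma tendsto_geometric_factor {a b : ℝ} (ha : 0 < a) (s : ℝ) :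
    Tendsto (fun p : ℕ × ℝ => ((p.2 / p.1 : ℝ) : ℂ) /
      (1 - Complex.exp (-(p.2 / p.1 : ℝ) + (s / scale p.1 : ℝ) * Complex.I)))
      (atTop ×ˢ 𝓟 (Icc a b)) (𝓝 1) := by
  have h0 : Tendsto (fun p : ℕ × ℝ =>
      (1 - Complex.exp (-(p.2 / p.1 : ℝ) + (s / scale p.1 : ℝ) * Complex.I)) /
        ((p.2 / p.1 : ℝ) : ℂ) - 1) (atTop ×ˢ 𝓟 (Icc a b)) (𝓝 0) := by
    refine tendsto_zero_of_le (N := max 1 ⌈b + |s|⌉₊)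
      (g := fun n => (((b + |s|) ^ 2 + |s|) / a) / √(n : ℝ))
      (fun n hn θ hθ => ?_) (tendsto_const_div_sqrt _)
    have hn' : 1 ≤ n := le_of_max_le_left hn
    have hbs : b + |s| ≤ n := Nat.ceil_le.1 (le_of_max_le_right hn)
    have hn0 : (0 : ℝ) < n := by exact_mod_cast hn'
    have hn1 : (1 : ℝ) ≤ n := by exact_mod_cast hn'
    have hr1 : 1 ≤ √(n : ℝ) := Real.one_le_sqrt.2 hn1
    have hr0 : 0 < √(n : ℝ) := by linarith
    have hθ0 : 0 < θ := ha.trans_le hθ.1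
    have hb0 : 0 < b := hθ0.trans_le hθ.2
    set h : ℝ := θ / n with hh
    have hh0 : 0 < h := by positivity
    set t : ℝ := s / scale n with ht
    have htabs : |t| = |s| / (n * √n) := by
      rw [ht, abs_div, abs_of_pos (scale_pos hn'), scale]
    have htn : |t| ≤ |s| / n := by
      rw [htabs]
      gcongr
      exact le_mul_of_one_le_right hn0.le hr1
    set w : ℂ := -(h : ℂ) + (t : ℂ) * Complex.I with hw
    have hwn : ‖w‖ ≤ (b + |s|) / n := by
      have h1 : ‖w‖ ≤ ‖-(h : ℂ)‖ + ‖(t : ℂ) * Complex.I‖ := norm_add_le _ _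
      rw [norm_neg, norm_mul, Complex.norm_I, mul_one, Complex.norm_real, Complex.norm_real,
        Real.norm_eq_abs, Real.norm_eq_abs, abs_of_pos hh0] at h1
      have h2 : h ≤ b / n := by rw [hh]; gcongr; exact hθ.2
      rw [add_div]
      linarith
    have hw1 : ‖w‖ ≤ 1 := hwn.trans ((div_le_one hn0).2 hbs)
    have h3 := Complex.norm_exp_sub_one_sub_id_le hw1
    have hhC : (h : ℂ) ≠ 0 := by exact_mod_cast hh0.ne'
    have h4 : (1 - Complex.exp w) / (h : ℂ) - 1 =
        (-(Complex.exp w - 1 - w) - t * Complex.I) / h := by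
      field_simp
      rw [hw]
      ring
    rw [h4, norm_div, Complex.norm_real, Real.norm_eq_abs, abs_of_pos hh0, div_le_iff₀ hh0]
    have h5 : ‖-(Complex.exp w - 1 - w) - t * Complex.I‖ ≤ ‖w‖ ^ 2 + |t| := by
      refine (norm_sub_le _ _).trans ?_
      rw [norm_neg, norm_mul, Complex.norm_I, mul_one, Complex.norm_real, Real.norm_eq_abs]
      linarith
    refine h5.trans ?_
    have h6 : ‖w‖ ^ 2 ≤ (b + |s|) ^ 2 / (n * √n) := by
      refine (pow_le_pow_left₀ (norm_nonneg _) hwn 2).trans ?_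
      rw [div_pow]
      have : √(n : ℝ) ≤ n := Real.sqrt_le_iff.2 ⟨hn0.le, by nlinarith⟩
      gcongr
      rw [sq]
      gcongr
    have h7 : ((b + |s|) ^ 2 + |s|) / (n * √n) ≤ ((b + |s|) ^ 2 + |s|) / a / √n * h := by
      rw [hh]
      have : ((b + |s|) ^ 2 + |s|) / a / √n * (θ / n) =
          ((b + |s|) ^ 2 + |s|) / (n * √n) * (θ / a) := by field_simp
      rw [this]
      refine le_mul_of_one_le_right (by positivity) ((one_le_div ha).2 hθ.1)
    rw [htabs]
    rw [add_div] at h7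
    linarith
  have h1 := (h0.add_const 1).inv₀ (by simp)
  simpa using h1

lemma norm_geometric_factor_le {θ : ℝ} (hθ : 0 < θ) {n : ℕ} (hn : 1 ≤ n) (t : ℝ) :
    ‖((θ / n : ℝ) : ℂ) / (1 - Complex.exp (-(θ / n : ℝ) + t * Complex.I))‖ ≤ Real.exp θ := by
  have hn0 : (0 : ℝ) < n := by exact_mod_cast hn
  have hh : 0 < θ / n := by positivity
  have h1 := one_sub_exp_neg_le_norm (h := θ / n) t
  have h2 : Real.exp (-(θ / n)) < 1 := Real.exp_lt_one_iff.2 (by linarith)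
  rw [norm_div, Complex.norm_real, Real.norm_eq_abs, abs_of_pos hh, div_le_iff₀ (by linarith)]
  have h3 : Real.exp (θ / n) * (1 - Real.exp (-(θ / n))) = Real.exp (θ / n) - 1 := by
    rw [mul_sub, ← Real.exp_add]; simp
  have h4 := Real.add_one_le_exp (θ / n)
  calc θ / n ≤ Real.exp (θ / n) * (1 - Real.exp (-(θ / n))) := by linarith
    _ ≤ Real.exp θ * (1 - Real.exp (-(θ / n))) := by
        refine mul_le_mul_of_nonneg_right (Real.exp_le_exp.2 ?_) (by linarith)
        exact div_le_self hθ.le (by exact_mod_cast hn)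
    _ ≤ _ := by gcongr

lemma continuous_kernel {θ : ℝ} (hθ : 0 < θ) {n : ℕ} (hn : 1 ≤ n) : Continuous (kernel n θ) := by
  have hn0 : (0 : ℝ) < n := by exact_mod_cast hn
  have := continuous_tiltChar n θ
  unfold kernel
  refine Continuous.mul (by fun_prop) (Continuous.div (by fun_prop) (by fun_prop) fun s => ?_)
  exact one_sub_exp_neg_add_ne_zero (by positivity) _

lemma measurable_cutKernel {θ : ℝ} (hθ : 0 < θ) {n : ℕ} (hn : 1 ≤ n) :
    Measurable (cutKernel n θ) :=
  (continuous_kernel hθ hn).measurable.indicator measurableSet_Ioc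

lemma exists_norm_cutKernel_le (b : ℝ) :
    ∃ C, ∀ θ ∈ Ioc 0 b, ∀ n : ℕ, 1 ≤ n → ∀ s : ℝ,
      ‖cutKernel n θ s‖ ≤ C * (1 + s ^ 2)⁻¹ := by
  obtain ⟨C, hC0, hC⟩ := exists_norm_tiltChar_le b
  refine ⟨C * Real.exp b, fun θ hθ n hn s => ?_⟩
  by_cases hs : s ∈ Ioc (-(Real.pi * scale n)) (Real.pi * scale n)
  · rw [cutKernel, indicator_of_mem hs, kernel, norm_mul, norm_mul]
    have h1 := hC θ ⟨hθ.1.le, hθ.2⟩ n hn s (abs_le.2 ⟨hs.1.le, hs.2⟩)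
    have h2 := (norm_geometric_factor_le hθ.1 hn (s / scale n)).trans (Real.exp_le_exp.2 hθ.2)
    have h3 : ‖Complex.exp (-((cutoff n θ * (s / scale n) : ℝ) * Complex.I))‖ = 1 := by
      rw [Complex.norm_exp]; simp
    rw [h3, mul_one]
    refine (mul_le_mul h1 h2 (norm_nonneg _) (by positivity)).trans (le_of_eq ?_)
    rw [div_eq_mul_inv]; ring
  · rw [cutKernel, indicator_of_notMem hs, norm_zero]
    positivity

lemma tendsto_kernel_sub {a b : ℝ} (ha : 0 < a) (s : ℝ) :
    Tendsto (fun p : ℕ × ℝ => kernel p.1 p.2 s - (Real.exp (-(s ^ 2 / 2 * intCGF'' p.2)) : ℝ))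
      (atTop ×ˢ 𝓟 (Icc a b)) (𝓝 0) := by
  have h1 := (tendsto_tiltChar_centered (Icc a b) s).add
    (tendsto_exp_tiltVar (isCompact_Icc (a := a) (b := b)) s)
  have h2 := (tendsto_exp_mean_sub_cutoff (isCompact_Icc (a := a) (b := b)) s).mul
    (tendsto_geometric_factor (b := b) ha s)
  have h3 := h1.mul h2
  -- With A the centred characteristic function, G the Gaussian and F the remaining factors, kernel
  -- - G = (A - G)F + G(F - 1); this is the second term.
  have h4 : Tendsto (fun p : ℕ × ℝ => ((Real.exp (-(s ^ 2 / 2 * intCGF'' p.2)) : ℝ) : ℂ) *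
      (Complex.exp (((tiltMean p.1 p.2 - cutoff p.1 p.2) * (s / scale p.1) : ℝ) * Complex.I) *
        (((p.2 / p.1 : ℝ) : ℂ) /
          (1 - Complex.exp (-(p.2 / p.1 : ℝ) + (s / scale p.1 : ℝ) * Complex.I))) - 1))
      (atTop ×ˢ 𝓟 (Icc a b)) (𝓝 0) := by
    refine isBoundedUnder_le_mul_tendsto_zero ?_ ?_
    · refine isBoundedUnder_of ⟨1, fun p => ?_⟩
      simp only [Function.comp_apply]
      rw [Complex.norm_real, Real.norm_eq_abs, abs_of_pos (Real.exp_pos _), Real.exp_le_one_iff]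
      have := (intCGF''_pos p.2).le
      have : 0 ≤ s ^ 2 / 2 * intCGF'' p.2 := by positivity
      linarith
    · have := h2.sub_const 1
      simpa using this
  have h5 := h3.add h4
  simp only [add_zero, zero_mul] at h5
  refine h5.congr fun p => ?_
  have e1 : Complex.exp (-((cutoff p.1 p.2 * (s / scale p.1) : ℝ) * Complex.I)) =
      Complex.exp (-((tiltMean p.1 p.2 * (s / scale p.1) : ℝ) * Complex.I)) *
      Complex.exp (((tiltMean p.1 p.2 - cutoff p.1 p.2) * (s / scale p.1) : ℝ) * Complex.I) := by
    rw [← Complex.exp_add]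
    congr 1
    push_cast
    ring
  rw [kernel, e1]
  ring

/-- For fixed s the truncation is eventually inactive, as |s| < n ≤ π n^{3/2}. -/
lemma tendsto_cutKernel_sub {a b : ℝ} (ha : 0 < a) (s : ℝ) :
    Tendsto (fun p : ℕ × ℝ => cutKernel p.1 p.2 s -
      (Real.exp (-(s ^ 2 / 2 * intCGF'' p.2)) : ℝ)) (atTop ×ˢ 𝓟 (Icc a b)) (𝓝 0) := by
  refine (tendsto_kernel_sub ha s).congr' ?_
  rw [EventuallyEq, eventually_prod_principal_iff]
  filter_upwards [eventually_ge_atTop (max 1 (⌈|s|⌉₊ + 1))] with n hn θ _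
  have hn1 : 1 ≤ n := le_of_max_le_left hn
  have hn1' : (1 : ℝ) ≤ n := by exact_mod_cast hn1
  have hsn : |s| < n := Nat.lt_of_ceil_lt (by have := le_of_max_le_right hn; omega)
  have hT : (n : ℝ) ≤ Real.pi * scale n := by
    have h1 : 1 ≤ √(n : ℝ) := Real.one_le_sqrt.2 hn1'
    have h2 : (1 : ℝ) ≤ Real.pi := by linarith [Real.pi_gt_three]
    rw [scale]
    nlinarith [mul_le_mul h2 h1 zero_le_one (by linarith)]
  have := abs_lt.1 (hsn.trans_le hT)
  have hmem : s ∈ Ioc (-(Real.pi * scale n)) (Real.pi * scale n) := ⟨this.1, this.2.le⟩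
  rw [cutKernel, indicator_of_mem hmem]

lemma integral_gaussian_intCGF'' (θ : ℝ) :
    ∫ s : ℝ, ((Real.exp (-(s ^ 2 / 2 * intCGF'' θ)) : ℝ) : ℂ) =
      (√(2 * Real.pi / intCGF'' θ) : ℝ) := by
  have h := integral_gaussian (intCGF'' θ / 2)
  rw [integral_complex_ofReal]
  congr 1
  have e1 : 2 * Real.pi / intCGF'' θ = Real.pi / (intCGF'' θ / 2) := by
    have := (intCGF''_pos θ).ne'
    field_simp
  rw [e1, ← h]
  refine integral_congr_ae (Eventually.of_forall fun s => ?_)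
  simp only
  congr 1; ring

/-- Dominated convergence along the product filter. The Gaussians, which vary with θ, are dominated
by the one whose parameter is the minimum of K̃'' on [a, b]. -/
lemma tendsto_integral_cutKernel_sub {a b : ℝ} (ha : 0 < a) :
    Tendsto (fun p : ℕ × ℝ => (∫ s, cutKernel p.1 p.2 s) - (√(2 * Real.pi / intCGF'' p.2) : ℝ))
      (atTop ×ˢ 𝓟 (Icc a b)) (𝓝 0) := by
  rcases lt_or_ge b a with hab | hab
  · simp [Icc_eq_empty_of_lt hab]
  obtain ⟨C, hC⟩ := exists_norm_cutKernel_le b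
  obtain ⟨θ₀, _, hmin⟩ := (isCompact_Icc (a := a) (b := b)).exists_isMinOn
    (nonempty_Icc.2 hab) continuous_intCGF''.continuousOn
  set κ := intCGF'' θ₀ with hκ
  have hκ0 : 0 < κ := intCGF''_pos θ₀
  have hgauss : ∀ k : ℝ, 0 < k → Integrable fun s : ℝ => Real.exp (-(s ^ 2 / 2 * k)) := by
    intro k hk
    have := integrable_exp_neg_mul_sq (half_pos hk)
    refine this.congr (Eventually.of_forall fun s => ?_)
    simp only
    congr 1; ring
  have hev : ∀ᶠ p : ℕ × ℝ in atTop ×ˢ 𝓟 (Icc a b), 1 ≤ p.1 ∧ p.2 ∈ Icc a b := by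
    rw [eventually_prod_principal_iff]
    filter_upwards [eventually_ge_atTop 1] with n hn θ hθ using ⟨hn, hθ⟩
  have key := tendsto_integral_filter_of_dominated_convergence (μ := volume)
    (l := atTop ×ˢ 𝓟 (Icc a b))
    (F := fun (p : ℕ × ℝ) (s : ℝ) => cutKernel p.1 p.2 s -
      (Real.exp (-(s ^ 2 / 2 * intCGF'' p.2)) : ℝ)) (f := fun _ => 0)
    (fun s => C * (1 + s ^ 2)⁻¹ + Real.exp (-(s ^ 2 / 2 * κ)))
    (by
      filter_upwards [hev] with p hp
      have := measurable_cutKernel (ha.trans_le hp.2.1) hp.1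
      exact Measurable.aestronglyMeasurable (by fun_prop))
    (by
      filter_upwards [hev] with p hp
      refine Eventually.of_forall fun s => (norm_sub_le _ _).trans (add_le_add ?_ ?_)
      · exact hC p.2 ⟨ha.trans_le hp.2.1, hp.2.2⟩ p.1 hp.1 s
      · rw [Complex.norm_real, Real.norm_eq_abs, abs_of_pos (Real.exp_pos _), Real.exp_le_exp]
        have : κ ≤ intCGF'' p.2 := hmin hp.2
        have : s ^ 2 / 2 * κ ≤ s ^ 2 / 2 * intCGF'' p.2 := by gcongr
        linarith)
    ((integrable_inv_one_add_sq.const_mul C).add (hgauss κ hκ0))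
    (Eventually.of_forall fun s => tendsto_cutKernel_sub ha s)
  rw [integral_zero] at key
  refine key.congr' ?_
  filter_upwards [hev] with p hp
  have hθ0 := ha.trans_le hp.2.1
  rw [integral_sub, integral_gaussian_intCGF'']
  · exact (integrable_inv_one_add_sq.const_mul C).mono'
      (measurable_cutKernel hθ0 hp.1).aestronglyMeasurable
      (Eventually.of_forall fun s => hC p.2 ⟨hθ0, hp.2.2⟩ p.1 hp.1 s)
  · exact (hgauss _ (intCGF''_pos p.2)).ofReal

/-! ### The tail probability compared with its approximation -/

/-- Substituting t = s/n^{3/2} and extracting n/θ from the geometric factor leaves the prefactor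
1/(θ√n). -/
lemma measureReal_wsum_le_cutoff {n : ℕ} (hn : 1 ≤ n) {θ : ℝ} (hθ : 0 < θ) :
    (((bitsLaw n).real {b | wsum b ≤ cutoff n θ} : ℝ) : ℂ) =
      ((Real.exp (sumCGF n θ + θ * cutoff n θ / n) / (2 * Real.pi * θ * √n) : ℝ) : ℂ) *
        ∫ s, cutKernel n θ s := by
  have hn0 : (0 : ℝ) < n := by exact_mod_cast hn
  have hr0 : 0 < √(n : ℝ) := Real.sqrt_pos.2 hn0
  have hT := scale_pos hn
  have hpi := Real.pi_pos
  rw [measureReal_wsum_le (cutoff n θ) (h := θ / n) (by positivity)]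
  have h1 : ∀ t : ℝ, Complex.exp (-((-(θ / n : ℝ) + t * Complex.I) * cutoff n θ)) *
      (∏ i : Fin n, (1 + Complex.exp ((-(θ / n : ℝ) + t * Complex.I) * ((i : ℝ) + 1 : ℝ))) / 2) /
      (1 - Complex.exp (-(θ / n : ℝ) + t * Complex.I)) =
      ((Real.exp (sumCGF n θ + θ * cutoff n θ / n) * (n / θ) : ℝ) : ℂ) *
        kernel n θ (t * scale n) := by
    intro t
    rw [prod_eq_tiltChar hn, kernel, mul_div_cancel_right₀ _ hT.ne']
    have e1 : Complex.exp (-((-(θ / n : ℝ) + t * Complex.I) * cutoff n θ)) =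
        (Real.exp (θ * cutoff n θ / n) : ℝ) *
          Complex.exp (-((cutoff n θ * t : ℝ) * Complex.I)) := by
      rw [Complex.ofReal_exp, ← Complex.exp_add]
      congr 1
      push_cast
      ring
    have e2 : ((n / θ : ℝ) : ℂ) * ((θ / n : ℝ) : ℂ) = 1 := by
      rw [← Complex.ofReal_mul, div_mul_div_cancel₀ hθ.ne', div_self hn0.ne', Complex.ofReal_one]
    rw [e1, Real.exp_add, Complex.ofReal_mul (_ * _) (_ / _), Complex.ofReal_mul (Real.exp _)]
    linear_combination (-(Real.exp (θ * cutoff n θ / n) : ℂ) *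
      Complex.exp (-((cutoff n θ * t : ℝ) * Complex.I)) * (Real.exp (sumCGF n θ)) *
      tiltChar n θ t / (1 - Complex.exp (-(θ / n : ℝ) + t * Complex.I))) * e2
  simp only [h1]
  rw [intervalIntegral.integral_const_mul, intervalIntegral.integral_comp_mul_right _ hT.ne',
    cutKernel, integral_indicator measurableSet_Ioc, ← intervalIntegral.integral_of_le (by
      have : 0 ≤ Real.pi * scale n := by positivity
      linarith), neg_mul, Complex.real_smul, ← mul_assoc, ← mul_assoc]
  congr 1
  have e3 : 1 / (2 * Real.pi) * (Real.exp (sumCGF n θ + θ * cutoff n θ / n) * (n / θ)) *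
      (scale n)⁻¹ = Real.exp (sumCGF n θ + θ * cutoff n θ / n) / (2 * Real.pi * θ * √n) := by
    rw [scale]
    field_simp
  rw [← e3]
  push_cast
  ring

/-- The sharp large deviation approximation to `Pr[H̃_n ≥ K̃'(θ)]`. -/
def tailApprox (n : ℕ) (θ : ℝ) : ℝ :=
  Real.exp (-(n * (θ * intCGF' θ - intCGF θ)) + corr θ) / (θ * √(2 * Real.pi * n * intCGF'' θ))

/-- The right tail probability `Pr[H̃_n ≥ d]`. -/
def tailProb (n : ℕ) (d : ℝ) : ℝ := (bitsLaw n).real {b | d ≤ Ht n b}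

lemma measurableSet_le_Ht (n : ℕ) (d : ℝ) : MeasurableSet {b | d ≤ Ht n b} := by
  refine measurableSet_le measurable_const ?_
  unfold Ht H
  fun_prop

lemma tailApprox_pos {n : ℕ} (hn : 1 ≤ n) {θ : ℝ} (hθ : 0 < θ) : 0 < tailApprox n θ := by
  have hn0 : (0 : ℝ) < n := by exact_mod_cast hn
  have := intCGF''_pos θ
  have := Real.pi_pos
  unfold tailApprox
  positivity

lemma tailApprox_eq_sqrt {n : ℕ} {θ : ℝ} (hθ : 0 < θ) :
    tailApprox n θ = √((1 + Real.exp (-θ)) / (4 * Real.pi * n * intCGF'' θ * θ ^ 2)) *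
      Real.exp (-(n * (θ * intCGF' θ - intCGF θ))) := by
  have := intCGF''_pos θ
  have := Real.pi_pos
  have h1 : Real.exp (corr θ) = √((1 + Real.exp (-θ)) / 2) := by
    rw [Real.sqrt_eq_rpow, Real.rpow_def_of_pos (by positivity), corr, mul_comm]
  have h2 : (1 + Real.exp (-θ)) / (4 * Real.pi * n * intCGF'' θ * θ ^ 2) =
      ((1 + Real.exp (-θ)) / 2) / (θ ^ 2 * (2 * Real.pi * n * intCGF'' θ)) := by
    rw [div_div]; congr 1; ring
  have h3 : 0 ≤ (1 + Real.exp (-θ)) / 2 := by positivity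
  rw [tailApprox, Real.exp_add, h1, h2, Real.sqrt_div h3, Real.sqrt_mul (sq_nonneg θ),
    Real.sqrt_sq hθ.le]
  ring

lemma tailProb_eq {n : ℕ} (hn : 1 ≤ n) (θ : ℝ) :
    tailProb n (intCGF' θ) = (bitsLaw n).real {b | wsum b ≤ cutoff n θ} := by
  have hn0 : (0 : ℝ) < n := by exact_mod_cast hn
  refine measureReal_congr ?_
  filter_upwards [ae_bits n] with b hb
  obtain ⟨s, hs⟩ := hb
  refine propext ?_
  change intCGF' θ ≤ Ht n b ↔ wsum b ≤ cutoff n θ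
  have h0 : 0 ≤ (n : ℝ) ^ 2 * -intCGF' θ := by
    have := intCGF'_nonpos θ
    exact mul_nonneg (by positivity) (by linarith)
  rw [Ht_eq, hs, Nat.cast_le, cutoff, Nat.le_floor_iff h0, le_neg, one_div_mul_eq_div,
    div_le_iff₀ (by positivity), mul_comm (-intCGF' θ)]

/-- The ratio splits into the trapezoidal error, the rounding error of the cutoff and the normalized
integral; each factor tends to 1 uniformly. -/
lemma tailProb_div_tailApprox {n : ℕ} (hn : 1 ≤ n) {θ : ℝ} (hθ : 0 < θ) :
    ((tailProb n (intCGF' θ) / tailApprox n θ : ℝ) : ℂ) =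
      ((Real.exp (sumCGF n θ - n * intCGF θ - corr θ) *
        Real.exp (θ * ((cutoff n θ - (n : ℝ) ^ 2 * -intCGF' θ) / n)) : ℝ) : ℂ) *
        ((√(intCGF'' θ / (2 * Real.pi)) : ℝ) * ∫ s, cutKernel n θ s) := by
  have hn0 : (0 : ℝ) < n := by exact_mod_cast hn
  have hr0 : 0 < √(n : ℝ) := Real.sqrt_pos.2 hn0
  have hK := intCGF''_pos θ
  have hpi := Real.pi_pos
  rw [tailProb_eq hn, Complex.ofReal_div, measureReal_wsum_le_cutoff hn hθ, mul_div_right_comm,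
    ← Complex.ofReal_div, ← mul_assoc, ← Complex.ofReal_mul]
  congr 2
  have e1 : Real.exp (sumCGF n θ + θ * cutoff n θ / n) =
      Real.exp (-(n * (θ * intCGF' θ - intCGF θ)) + corr θ) *
      (Real.exp (sumCGF n θ - n * intCGF θ - corr θ) *
        Real.exp (θ * ((cutoff n θ - (n : ℝ) ^ 2 * -intCGF' θ) / n))) := by
    rw [← Real.exp_add, ← Real.exp_add]
    congr 1
    field_simp
    ring
  have e2 : √(2 * Real.pi * n * intCGF'' θ) =
      √(intCGF'' θ / (2 * Real.pi)) * (2 * Real.pi * √n) := by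
    have : 2 * Real.pi * n * intCGF'' θ =
        intCGF'' θ / (2 * Real.pi) * ((2 * Real.pi) ^ 2 * n) := by field_simp
    rw [this, Real.sqrt_mul (by positivity), Real.sqrt_mul (by positivity),
      Real.sqrt_sq (by positivity)]
  rw [tailApprox, e1, e2]
  have := Real.exp_pos (-(n * (θ * intCGF' θ - intCGF θ)) + corr θ)
  field_simp

lemma tendsto_tailProb_div_tailApprox {a b : ℝ} (ha : 0 < a) :
    Tendsto (fun p : ℕ × ℝ => tailProb p.1 (intCGF' p.2) / tailApprox p.1 p.2)
      (atTop ×ˢ 𝓟 (Icc a b)) (𝓝 1) := by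
  have hev : ∀ᶠ p : ℕ × ℝ in atTop ×ˢ 𝓟 (Icc a b), 1 ≤ p.1 ∧ p.2 ∈ Icc a b := by
    rw [eventually_prod_principal_iff]
    filter_upwards [eventually_ge_atTop 1] with n hn θ hθ using ⟨hn, hθ⟩
  have hS : IsCompact (Icc a b) := isCompact_Icc
  have h1 : Tendsto (fun p : ℕ × ℝ => sumCGF p.1 p.2 - p.1 * intCGF p.2 - corr p.2)
      (atTop ×ˢ 𝓟 (Icc a b)) (𝓝 0) := by
    obtain ⟨C, hC⟩ := exists_sumCGF_sub_le hS
    exact tendsto_zero_of_le (N := 1) (fun n hn θ hθ => hC θ hθ n hn)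
      (tendsto_const_div_atTop_nhds_zero_nat C)
  have h2 : Tendsto (fun p : ℕ × ℝ =>
      p.2 * ((cutoff p.1 p.2 - (p.1 : ℝ) ^ 2 * -intCGF' p.2) / p.1))
      (atTop ×ˢ 𝓟 (Icc a b)) (𝓝 0) := by
    refine tendsto_zero_of_le (N := 1) (g := fun n => b / (n : ℝ)) (fun n hn θ hθ => ?_)
      (tendsto_const_div_atTop_nhds_zero_nat b)
    have hn0 : (0 : ℝ) < n := by exact_mod_cast hn
    have hθ0 : 0 < θ := ha.trans_le hθ.1
    rw [Real.norm_eq_abs, abs_mul, abs_div, abs_of_pos hn0, abs_of_pos hθ0, ← mul_div_assoc]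
    have := mul_le_mul hθ.2 (abs_cutoff_sub_le n θ) (abs_nonneg _) (hθ0.le.trans hθ.2)
    rw [mul_one] at this
    gcongr
  have h3 : Tendsto (fun p : ℕ × ℝ => ((√(intCGF'' p.2 / (2 * Real.pi)) : ℝ) : ℂ) *
      ∫ s, cutKernel p.1 p.2 s) (atTop ×ˢ 𝓟 (Icc a b)) (𝓝 1) := by
    have hcont : Continuous fun θ => ((√(intCGF'' θ / (2 * Real.pi)) : ℝ) : ℂ) := by
      have := continuous_intCGF''
      fun_prop
    obtain ⟨M, hM⟩ := hS.exists_bound_of_continuousOn hcont.continuousOn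
    have hbdd : IsBoundedUnder (· ≤ ·) (atTop ×ˢ 𝓟 (Icc a b))
        (norm ∘ fun p : ℕ × ℝ => ((√(intCGF'' p.2 / (2 * Real.pi)) : ℝ) : ℂ)) :=
      isBoundedUnder_of_eventually_le (a := M) (hev.mono fun p hp => hM p.2 hp.2)
    have h4 := (isBoundedUnder_le_mul_tendsto_zero hbdd
      (tendsto_integral_cutKernel_sub (b := b) ha)).add_const 1
    rw [zero_add] at h4
    refine h4.congr fun p => ?_
    have hK := intCGF''_pos p.2
    have hpi := Real.pi_pos
    have e : √(intCGF'' p.2 / (2 * Real.pi)) * √(2 * Real.pi / intCGF'' p.2) = 1 := by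
      rw [← Real.sqrt_mul (by positivity), div_mul_div_cancel₀ (by positivity),
        div_self hK.ne', Real.sqrt_one]
    have e' : ((√(intCGF'' p.2 / (2 * Real.pi)) : ℝ) : ℂ) *
        (√(2 * Real.pi / intCGF'' p.2) : ℝ) = 1 := by
      rw [← Complex.ofReal_mul, e, Complex.ofReal_one]
    rw [mul_sub, e', sub_add_cancel]
  have h5 := ((Real.continuous_exp.tendsto 0).comp h1).mul
    ((Real.continuous_exp.tendsto 0).comp h2)
  have h6 := ((Complex.continuous_ofReal.tendsto _).comp h5).mul h3
  rw [Real.exp_zero, mul_one, mul_one, Complex.ofReal_one] at h6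
  have h7 : Tendsto (fun p : ℕ × ℝ =>
      ((tailProb p.1 (intCGF' p.2) / tailApprox p.1 p.2 : ℝ) : ℂ))
      (atTop ×ˢ 𝓟 (Icc a b)) (𝓝 1) := by
    refine h6.congr' ?_
    filter_upwards [hev] with p hp
    exact (tailProb_div_tailApprox hp.1 (ha.trans_le hp.2.1)).symm
  simpa [Function.comp_def] using (Complex.continuous_re.tendsto 1).comp h7

/-! ### Uniformity in the threshold -/

/-- The saddlepoint `θ̃_d`. -/
def saddle : ℝ → ℝ := Function.invFun intCGF'

lemma saddle_intCGF' (θ : ℝ) : saddle (intCGF' θ) = θ :=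
  Function.leftInverse_invFun strictMono_intCGF'.injective θ

lemma intCGF'_saddle {d : ℝ} (hd : d ∈ Ioo (-1 / 2 : ℝ) 0) : intCGF' (saddle d) = d :=
  Function.invFun_eq (exists_intCGF'_eq hd)

/-- The relative error of the right tail approximation. -/
def relError (n : ℕ) (d : ℝ) : ℝ := tailProb n d / tailApprox n (saddle d) - 1

lemma tailProb_eq_mul {n : ℕ} (hn : 1 ≤ n) {θ : ℝ} (hθ : 0 < θ) :
    tailProb n (intCGF' θ) = tailApprox n θ * (1 + relError n (intCGF' θ)) := by
  rw [relError, saddle_intCGF', add_sub_cancel, mul_div_cancel₀ _ (tailApprox_pos hn hθ).ne']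

/-- Monotonicity of K̃' sends the thresholds into a compact interval of saddlepoints. Its left end
is positive because -ω₂ > -1/4 = K̃'(0). -/
lemma tendstoUniformlyOn_relError {ω₁ ω₂ : ℝ} (hω₁ : 0 < ω₁) (hω : ω₁ ≤ ω₂) (hω₂ : ω₂ < 1 / 4) :
    TendstoUniformlyOn relError (fun _ => 0) atTop (Icc (-ω₂) (-ω₁)) := by
  have hmem : ∀ d ∈ Icc (-ω₂) (-ω₁), d ∈ Ioo (-1 / 2 : ℝ) 0 := fun d hd =>
    ⟨by linarith [hd.1], by linarith [hd.2]⟩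
  have hm2 := intCGF'_saddle (hmem (-ω₂) ⟨le_rfl, by linarith⟩)
  have hm1 := intCGF'_saddle (hmem (-ω₁) ⟨by linarith, le_rfl⟩)
  have ha : 0 < saddle (-ω₂) := by
    rw [← strictMono_intCGF'.lt_iff_lt, hm2, intCGF'_zero]
    linarith
  have hmap : Tendsto (fun p : ℕ × ℝ => (p.1, saddle p.2)) (atTop ×ˢ 𝓟 (Icc (-ω₂) (-ω₁)))
      (atTop ×ˢ 𝓟 (Icc (saddle (-ω₂)) (saddle (-ω₁)))) := by
    refine tendsto_fst.prodMk (tendsto_principal.2 ?_)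
    rw [eventually_prod_principal_iff]
    refine Eventually.of_forall fun n d hd => ?_
    have h := intCGF'_saddle (hmem d hd)
    constructor
    · rw [← strictMono_intCGF'.le_iff_le, hm2, h]; exact hd.1
    · rw [← strictMono_intCGF'.le_iff_le, hm1, h]; exact hd.2
  have h1 := ((tendsto_tailProb_div_tailApprox (b := saddle (-ω₁)) ha).comp hmap).sub_const 1
  rw [sub_self] at h1
  rw [tendstoUniformlyOn_iff_tendsto]
  have h2 : Tendsto (fun p : ℕ × ℝ => relError p.1 p.2) (atTop ×ˢ 𝓟 (Icc (-ω₂) (-ω₁))) (𝓝 0) := by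
    refine h1.congr' ?_
    have hev : ∀ᶠ p : ℕ × ℝ in atTop ×ˢ 𝓟 (Icc (-ω₂) (-ω₁)), p.2 ∈ Icc (-ω₂) (-ω₁) := by
      rw [eventually_prod_principal_iff]
      exact Eventually.of_forall fun _ _ hd => hd
    filter_upwards [hev] with p hp
    simp only [Function.comp_apply]
    rw [intCGF'_saddle (hmem _ hp), relError]
  rw [Metric.uniformity_eq_comap_nhds_zero, tendsto_comap_iff]
  simpa [Function.comp_def, Real.dist_eq] using h2.abs

/-! ### Reflection to the left tail, and the theorem -/

lemma hasDerivAt_K (θ : ℝ) : HasDerivAt K (-intCGF' (-θ)) θ := by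
  rw [K_eq]
  exact ((hasDerivAt_intCGF (-θ)).comp θ (hasDerivAt_neg θ)).congr_deriv (by simp)

lemma deriv_K : deriv K = fun θ => -intCGF' (-θ) := funext fun θ => (hasDerivAt_K θ).deriv

lemma deriv_deriv_K : deriv (deriv K) = fun θ => intCGF'' (-θ) := by
  rw [deriv_K]
  funext θ
  exact ((((hasDerivAt_intCGF' (-θ)).comp θ (hasDerivAt_neg θ)).neg).congr_deriv (by simp)).deriv

lemma legendre_K (d : ℝ) : legendre K d = legendre intCGF (-d) := by
  rw [legendre, legendre, K_eq]
  refine (Equiv.neg ℝ).iSup_congr fun θ => ?_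
  simp

end StrongLD

end

theorem theorem3 (ω₁ ω₂ : ℝ) (hω₁ : 0 < ω₁) (hω : ω₁ ≤ ω₂) (hω₂ : ω₂ < 1 / 4) :
    -- the limits defining `K̃` and `K` exist and are given by the integral formulas
    (∀ θ : ℝ, Tendsto (fun n => StrongLD.normCGF StrongLD.Ht n θ) atTop (𝓝 (StrongLD.Kt θ)) ∧
      StrongLD.Kt θ = ∫ x in (0 : ℝ)..1, Real.log ((1 + Real.exp (-(θ * x))) / 2)) ∧
    (∀ θ : ℝ, Tendsto (fun n => StrongLD.normCGF StrongLD.H n θ) atTop (𝓝 (StrongLD.K θ)) ∧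
      StrongLD.K θ = ∫ x in (0 : ℝ)..1, Real.log ((1 + Real.exp (θ * x)) / 2)) ∧
    -- `K̃` and `K` are twice continuously differentiable with positive second derivatives
    (ContDiff ℝ 2 StrongLD.Kt ∧ ∀ θ : ℝ, 0 < deriv (deriv StrongLD.Kt) θ) ∧
    (ContDiff ℝ 2 StrongLD.K ∧ ∀ θ : ℝ, 0 < deriv (deriv StrongLD.K) θ) ∧
    -- the saddlepoints exist, are unique, and the suprema in the rate functions are finite
    (∀ dt ∈ Ioo (-1 / 2 : ℝ) 0, (∃! θ : ℝ, deriv StrongLD.Kt θ = dt) ∧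
      BddAbove (range fun θ : ℝ => θ * dt - StrongLD.Kt θ)) ∧
    (∀ d ∈ Ioo (0 : ℝ) (1 / 2), (∃! θ : ℝ, deriv StrongLD.K θ = d) ∧
      BddAbove (range fun θ : ℝ => θ * d - StrongLD.K θ)) ∧
    -- right-tail expansion, with deterministic remainder uniform over `[-ω₂, -ω₁]`
    (∃ ρt : ℕ → ℝ → ℝ,
      TendstoUniformlyOn ρt (fun _ => 0) atTop (Icc (-ω₂) (-ω₁)) ∧
      ∀ dt ∈ Icc (-ω₂) (-ω₁), ∀ θ : ℝ, deriv StrongLD.Kt θ = dt →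
        0 < θ ∧
        ∀ n : ℕ, 1 ≤ n →
        ∀ (Ω : Type*) (_ : MeasurableSpace Ω) (P : Measure Ω) (_ : IsProbabilityMeasure P)
          (B : Fin n → Ω → ℝ) (_ : ∀ i, HasLaw (B i) StrongLD.fairBernoulli P)
          (_ : iIndepFun B P),
          P.real {ω | dt ≤ StrongLD.Ht n (fun i => B i ω)} =
            Real.exp (-(n * StrongLD.legendre StrongLD.Kt dt) + StrongLD.corr θ) /
              (θ * √(2 * Real.pi * n * deriv (deriv StrongLD.Kt) θ)) * (1 + ρt n dt) ∧
          P.real {ω | dt ≤ StrongLD.Ht n (fun i => B i ω)} =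
            √((1 + Real.exp (-θ)) /
                (4 * Real.pi * n * deriv (deriv StrongLD.Kt) θ * θ ^ 2)) *
              Real.exp (-(n * StrongLD.legendre StrongLD.Kt dt)) * (1 + ρt n dt)) ∧
    -- left-tail expansion, with deterministic remainder uniform over `[ω₁, ω₂]`
    (∃ ρ : ℕ → ℝ → ℝ,
      TendstoUniformlyOn ρ (fun _ => 0) atTop (Icc ω₁ ω₂) ∧
      ∀ d ∈ Icc ω₁ ω₂, ∀ θ : ℝ, deriv StrongLD.K θ = d →
        θ < 0 ∧
        ∀ n : ℕ, 1 ≤ n →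
        ∀ (Ω : Type*) (_ : MeasurableSpace Ω) (P : Measure Ω) (_ : IsProbabilityMeasure P)
          (B : Fin n → Ω → ℝ) (_ : ∀ i, HasLaw (B i) StrongLD.fairBernoulli P)
          (_ : iIndepFun B P),
          P.real {ω | StrongLD.H n (fun i => B i ω) ≤ d} =
            √((1 + Real.exp θ) /
                (4 * Real.pi * deriv (deriv StrongLD.K) θ * θ ^ 2)) / √n *
              Real.exp (-(n * StrongLD.legendre StrongLD.K d)) * (1 + ρ n d)) := by
  have hposA : ∀ dt ∈ Icc (-ω₂) (-ω₁), ∀ θ : ℝ, StrongLD.intCGF' θ = dt → 0 < θ := by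
    intro dt hdt θ hθ
    rw [← StrongLD.strictMono_intCGF'.lt_iff_lt, StrongLD.intCGF'_zero, hθ]
    linarith [hdt.1]
  have hunif := StrongLD.tendstoUniformlyOn_relError hω₁ hω hω₂
  refine ⟨?_, ?_, ?_, ?_, ?_, ?_, ⟨StrongLD.relError, hunif, ?_⟩,
    -- The left-tail remainder is the right-tail one at -d, since H ≤ d means -d ≤ H̃.
    ⟨fun n d => StrongLD.relError n (-d), ?_, ?_⟩⟩
  · intro θ
    rw [StrongLD.Kt_eq]
    exact ⟨StrongLD.tendsto_normCGF_Ht θ, rfl⟩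
  · intro θ
    rw [StrongLD.K_eq]
    refine ⟨StrongLD.tendsto_normCGF_H θ, ?_⟩
    simp only [StrongLD.intCGF, StrongLD.bitCGF, neg_mul, neg_neg]
  · rw [StrongLD.Kt_eq, StrongLD.deriv_intCGF, StrongLD.deriv_intCGF']
    exact ⟨StrongLD.contDiff_intCGF, StrongLD.intCGF''_pos⟩
  · rw [StrongLD.deriv_deriv_K, StrongLD.K_eq]
    exact ⟨StrongLD.contDiff_intCGF.comp contDiff_neg, fun θ => StrongLD.intCGF''_pos (-θ)⟩
  · intro dt hdt
    rw [StrongLD.Kt_eq, StrongLD.deriv_intCGF]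
    obtain ⟨θ, hθ⟩ := StrongLD.exists_intCGF'_eq hdt
    exact ⟨⟨θ, hθ, fun η hη => StrongLD.strictMono_intCGF'.injective (hη.trans hθ.symm)⟩,
      StrongLD.bddAbove_intCGF_legendre hθ⟩
  · intro d hd
    rw [StrongLD.deriv_K, StrongLD.K_eq]
    obtain ⟨θ, hθ⟩ := StrongLD.exists_intCGF'_eq (d := -d)
      ⟨by linarith [hd.2], by linarith [hd.1]⟩
    refine ⟨⟨-θ, by simp [hθ], fun η hη => ?_⟩, ?_⟩
    · have : StrongLD.intCGF' (-η) = StrongLD.intCGF' θ := by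
        rw [hθ, ← hη, neg_neg]
      rw [← StrongLD.strictMono_intCGF'.injective this, neg_neg]
    · obtain ⟨M, hM⟩ := StrongLD.bddAbove_intCGF_legendre hθ
      refine ⟨M, ?_⟩
      rintro _ ⟨η, rfl⟩
      have := hM ⟨-η, rfl⟩
      simpa using this
  · intro dt hdt θ hθ
    rw [StrongLD.Kt_eq, StrongLD.deriv_intCGF] at hθ
    have hθ0 := hposA dt hdt θ hθ
    refine ⟨hθ0, fun n hn Ω _ P _ B hB hind => ?_⟩
    have hprob : P.real {ω | dt ≤ StrongLD.Ht n (fun i => B i ω)} = StrongLD.tailProb n dt :=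
      StrongLD.measureReal_bits hB hind (StrongLD.measurableSet_le_Ht n dt)
    rw [hprob, StrongLD.Kt_eq, StrongLD.deriv_intCGF, StrongLD.deriv_intCGF',
      StrongLD.legendre_intCGF hθ]
    subst hθ
    have h := StrongLD.tailProb_eq_mul hn hθ0
    exact ⟨h, by rw [← StrongLD.tailApprox_eq_sqrt hθ0, h]⟩
  · have hmaps : MapsTo (fun d : ℝ => -d) (Icc ω₁ ω₂) (Icc (-ω₂) (-ω₁)) := fun d hd =>
      ⟨neg_le_neg hd.2, neg_le_neg hd.1⟩
    exact (hunif.comp (fun d : ℝ => -d)).mono hmaps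
  · intro d hd θ hθ
    rw [StrongLD.deriv_K] at hθ
    have hθ' : StrongLD.intCGF' (-θ) = -d := by rw [← hθ, neg_neg]
    have hθ0 := hposA (-d) ⟨neg_le_neg hd.2, neg_le_neg hd.1⟩ (-θ) hθ'
    refine ⟨neg_pos.1 hθ0, fun n hn Ω _ P _ B hB hind => ?_⟩
    have hset : {ω | StrongLD.H n (fun i => B i ω) ≤ d} =
        {ω | -d ≤ StrongLD.Ht n (fun i => B i ω)} := by
      ext ω
      change StrongLD.H n (fun i => B i ω) ≤ d ↔ -d ≤ -StrongLD.H n (fun i => B i ω)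
      exact neg_le_neg_iff.symm
    have hprob : P.real {ω | -d ≤ StrongLD.Ht n (fun i => B i ω)} = StrongLD.tailProb n (-d) :=
      StrongLD.measureReal_bits hB hind (StrongLD.measurableSet_le_Ht n (-d))
    have h := StrongLD.tailProb_eq_mul hn hθ0
    rw [hset, hprob, StrongLD.deriv_deriv_K, StrongLD.legendre_K, StrongLD.legendre_intCGF hθ',
      ← hθ', h, StrongLD.tailApprox_eq_sqrt hθ0, ← Real.sqrt_div' _ (Nat.cast_nonneg n), neg_neg,
      neg_sq, div_div]
    congr 4
    ring
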